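/- **Setting.** Let $\mathcal N\subset\mathcal M$ be a unital inclusion of finite von Neumann algebras, $\tau$ a normal faithful tracial state on $\mathcal M$, with $\mathcal M$ acting on $L^2(\mathcal M,\tau)$ by left multiplication, with cyclic vector $\Omega$ and modular conjugation $J(x\Omega)=x^*\Omega$. Let $e_1$ be the Jones projection onto $\overline{\mathcal N\Omega}$ and $\mathcal M_1=\langle\mathcal M,e_1\rangle$ the basic construction. Assume $(\mathcal M_1,\tau_1)$ is an extremal $\lambda$-extension: $\tau_1$ is a normal faithful tracial state on $\mathcal M_1$ extending $\tau$, $\mathbb E_{\mathcal M}(e_1)=\lambda$ for a constant $\lambda>0$, and $\tau_1(x)=\tau_1(Jx^*J)$ for $x\in\mathcal N'\cap\mathcal M$. Let $\Omega_1$ and $J_1$ be the cyclic vector and modular conjugation of $L^2(\mathcal M_1,\tau_1)$, $e_2$ the projection onto $\overline{\mathcal M\Omega_1}$, $\mathcal M_2=\langle\mathcal M_1,e_2\rangle$, and assume that $\tau_2$ is a normal faithful tracial state on $\mathcal M_2$ extending $\tau_1$ with $\mathbb E_{\mathcal M_1}(e_2)=\lambda$. All conditional expectations are trace preserving. The Fourier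 multiplier of an $\mathcal N$-bimodule map $\Phi$ on $\mathcal M$ is the unique $\widehat\Phi\in\mathcal M'\cap\mathcal M_2$ with $$\langle\widehat\Phi(x_1e_1y_1\Omega_1),x_2e_1y_2\Omega_1\rangle=\lambda^{3/2}\tau(y_2^*\Phi(x_2^*x_1)y_1),\qquad x_1,x_2,y_1,y_2\in\mathcal M .$$ For $x\in\mathcal M$ and $y\in\mathcal M'\cap\mathcal M_2$ put $x*y=\lambda^{-5/2}\mathbb E_{\mathcal M}(e_2e_1\,y\,x\,e_1e_2)$ and $\overline y=J_1y^*J_1$ (the contragredient). $\mathcal R(y)$ denotes the range projection. Let $\{\Phi_t\}_{t\ge0}$ be a norm-continuous semigroup of normal unital completely positive $\mathcal N$-bimodule maps on $\mathcal M$ with $\Phi_0=\mathrm{id}$, and let $\mathcal L$ be its bounded generator, $\Phi_t=e^{-t\mathcal L}$. Put $\widehat{\mathcal L}_0=-(1-e_2)\widehat{\mathcal L}(1-e_2)$, $$\mathcal L_a(x)=\tfrac12(1*\widehat{\mathcal L}_0)x+\tfrac12x(1*\widehat{\mathcal L}_0)-x*\widehat{\mathcal L}_0,\qquad \Phi^{(a)}_t=e^{-t\mathcal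 L_a},$$ $$\Gamma(x,y)=\tfrac12\bigl(y^*\mathcal L(x)+\mathcal L(y)^*x-\mathcal L(y^*x)\bigr),\qquad \mathrm{Ker}\,\Gamma=\{x\in\mathcal M:\Gamma(x,x)=0\},$$ $$\mathscr M(\{\Phi^{(a)}_t\})=\{x\in\mathcal M:\Phi^{(a)}_t(x)=x\ \ \forall t\ge0\},$$ $$\mathscr N(\{\Phi^{(a)}_t\})=\{x\in\mathcal M:\Phi^{(a)}_t(x^*)\Phi^{(a)}_t(x)=\Phi^{(a)}_t(x^*x),\ \Phi^{(a)}_t(x)\Phi^{(a)}_t(x^*)=\Phi^{(a)}_t(xx^*)\ \ \forall t\ge0\}.$$ The semigroup is *bimodule KMS symmetric with respect to* $\widehat\Delta$, where $\widehat\Delta\in\mathcal M'\cap\mathcal M_2$ is strictly positive (positive and invertible) with $\widehat\Delta e_2=e_2$ and $\mathcal R(\widehat{\mathcal L})\overline{\widehat\Delta}=\mathcal R(\widehat{\mathcal L})\widehat\Delta^{-1}$, if $\overline{\widehat{\mathcal L}}=\overline{\widehat\Delta}\,\widehat{\mathcal L}\,\overline{\widehat\Delta}$ and for every $t\ge0$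 the map $\Phi^{(a)}_t$ is equilibrium, i.e. leaves some normal faithful state on $\mathcal M$ invariant. It is *relatively ergodic* if $\mathcal R(\overline{\widehat{\mathcal L}_0})=\mathcal R(\widehat{\mathcal L}_0)$ and $\mathscr M(\{\Phi^{(a)}_t\})=\mathcal N$. **Lemma.** Suppose $\{\Phi_t\}_{t\ge0}$ is bimodule KMS symmetric with respect to $\widehat\Delta$ and relatively ergodic. Then $$\mathrm{Ker}\,\Gamma=\mathrm{Ker}\,\mathcal L_a=\mathscr N(\{\Phi^{(a)}_t\}_{t\ge0})=\mathscr M(\{\Phi^{(a)}_t\}_{t\ge0})=\mathcal N,$$ and $\mathrm{Ker}\,\Gamma$ is also equal to $\{x\in\mathcal M:\Gamma(x,y)=0\ \ \forall y\in\mathcal M\}$. -/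

import Mathlib

open scoped InnerProductSpace ComplexOrder NNReal

noncomputable section

/-! ### Von Neumann algebras as ordered C*-algebras -/

namespace VonNeumannAlgebra

variable {H : Type*} [NormedAddCommGroup H] [InnerProductSpace ℂ H] [CompleteSpace H]

instance instSMulMemClassComplex : SMulMemClass (VonNeumannAlgebra H) ℂ (H →L[ℂ] H) where
  smul_mem {s} c _ hx := s.toStarSubalgebra.smul_mem hx c

instance instIsClosedCoe (A : VonNeumannAlgebra H) : IsClosed (A : Set (H →L[ℂ] H)) := by
  rw [← A.centralizer_centralizer]
  exact Set.isClosed_centralizer _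

instance instCStarAlgebraCoe (A : VonNeumannAlgebra H) : CStarAlgebra A :=
  StarSubalgebra.cstarAlgebra A

/-- The order on a von Neumann algebra is inherited from the order of operators. -/
instance instPartialOrderCoe (A : VonNeumannAlgebra H) : PartialOrder A :=
  Subtype.partialOrder _

/-- The positive elements of a von Neumann algebra are the elements `s⋆ s` with `s` in it. -/
instance instStarOrderedRingCoe (A : VonNeumannAlgebra H) : StarOrderedRing A := by
  refine StarOrderedRing.of_nonneg_iff' (R := A) ?_ ?_
  · intro x y h z
    exact add_le_add_right (α := H →L[ℂ] H) (show (x : H →L[ℂ] H) ≤ y from h) z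
  · intro x
    constructor
    · intro h
      have h0 : (0 : H →L[ℂ] H) ≤ x := h
      have hmem : CFC.sqrt (x : H →L[ℂ] H) ∈ A := by
        refine (SetLike.ext_iff.1 A.commutant_commutant _).1 ?_
        rw [mem_commutant_iff]
        intro g hg
        rw [mem_commutant_iff] at hg
        have hc : Commute (x : H →L[ℂ] H) g := hg x x.2
        exact ((hc.cfcₙ_nnreal NNReal.sqrt).eq).symm
      refine ⟨⟨_, hmem⟩, Subtype.ext ?_⟩
      have hs : star (CFC.sqrt (x : H →L[ℂ] H)) = CFC.sqrt (x : H →L[ℂ] H) :=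
        (IsSelfAdjoint.of_nonneg (CFC.sqrt_nonneg _)).star_eq
      change (x : H →L[ℂ] H) = star (CFC.sqrt (x : H →L[ℂ] H)) * CFC.sqrt (x : H →L[ℂ] H)
      rw [hs, CFC.sqrt_mul_sqrt_self _ h0]
    · rintro ⟨s, rfl⟩
      exact star_mul_self_nonneg (s : H →L[ℂ] H)

/-- The identity representation of a von Neumann algebra on the space on which it acts. -/
def rep (A : VonNeumannAlgebra H) : A →⋆ₐ[ℂ] (H →L[ℂ] H) where
  toFun x := x
  map_one' := rfl
  map_mul' _ _ := rfl
  map_zero' := rfl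
  map_add' _ _ := rfl
  commutes' _ := rfl
  map_star' _ := rfl

/-- The von Neumann algebra generated by a set of operators: the double commutant of the
set together with the adjoints of its elements. -/
def generatedBy (S : Set (H →L[ℂ] H)) : VonNeumannAlgebra H where
  toStarSubalgebra := StarSubalgebra.centralizer ℂ (StarSubalgebra.centralizer ℂ S : Set (H →L[ℂ] H))
  centralizer_centralizer' := by simp

theorem subset_generatedBy (S : Set (H →L[ℂ] H)) : S ⊆ (generatedBy S : Set (H →L[ℂ] H)) := by
  intro x hx
  change x ∈ StarSubalgebra.centralizer ℂ (StarSubalgebra.centralizer ℂ S : Set (H →L[ℂ] H))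
  rw [StarSubalgebra.mem_centralizer_iff]
  intro g hg
  have h1 := (StarSubalgebra.mem_centralizer_iff ℂ).1 hg x hx
  have hg' : star g ∈ StarSubalgebra.centralizer ℂ S := star_mem hg
  have h2 := (StarSubalgebra.mem_centralizer_iff ℂ).1 hg' x hx
  exact ⟨h1.1.symm, h2.1.symm⟩

end VonNeumannAlgebra

/-! ### Representations with a distinguished vector -/

section Standard

variable {A : Type*} [CStarAlgebra A]
variable {K : Type*} [NormedAddCommGroup K] [InnerProductSpace ℂ K] [CompleteSpace K]

/-- The map `x ↦ π(x)ξ`. -/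
def orbitMap (π : A →⋆ₐ[ℂ] (K →L[ℂ] K)) (ξ : K) : A →ₗ[ℂ] K where
  toFun x := π x ξ
  map_add' _ _ := by simp
  map_smul' _ _ := by simp

/-- The Jones projection: the orthogonal projection onto the closure of `π(B)ξ`. -/
def jonesProjection (π : A →⋆ₐ[ℂ] (K →L[ℂ] K)) (ξ : K) (B : Set A) : K →L[ℂ] K :=
  (Submodule.span ℂ ((fun b => π b ξ) '' B)).topologicalClosure.starProjection

/-- The modular conjugation of a cyclic trace vector `ξ`: the continuous conjugate-linear
extension of `π(x)ξ ↦ π(x⋆)ξ`. -/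
def modularConjugation (π : A →⋆ₐ[ℂ] (K →L[ℂ] K)) (ξ : K) : K →SL[starRingEnd ℂ] K :=
  ((orbitMap π ξ).comp (starLinearEquiv ℂ : A ≃ₗ⋆[ℂ] A).toLinearMap :
    A →ₛₗ[starRingEnd ℂ] K).extendOfNorm (orbitMap π ξ)

/-- The range projection of a bounded operator. -/
def rangeProjection (T : K →L[ℂ] K) : K →L[ℂ] K :=
  (LinearMap.range (T : K →ₗ[ℂ] K)).topologicalClosure.starProjection

end Standard

section States

variable {A : Type*} [CStarAlgebra A] [PartialOrder A] [StarOrderedRing A]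

/-- A faithful normal state. Normal means: preserves suprema of increasing nets. -/
structure IsFaithfulNormalState (φ : A →ₚ[ℂ] ℂ) : Prop where
  map_one : φ 1 = 1
  faithful : ∀ x : A, φ (star x * x) = 0 → x = 0
  normal : ScottContinuous φ

/-- A faithful normal tracial state. -/
structure IsFaithfulNormalTrace (φ : A →ₚ[ℂ] ℂ) : Prop extends IsFaithfulNormalState φ where
  trace : ∀ x y : A, φ (x * y) = φ (y * x)

variable {B : Type*} [CStarAlgebra B]

/-- `b` is the value at `x` of the `φ`-preserving conditional expectation of `A` onto
its subalgebra `ι(B)`. -/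
def IsCondExp (φ : A →ₚ[ℂ] ℂ) (ι : B →⋆ₐ[ℂ] A) (x : A) (b : B) : Prop :=
  ∀ z : B, φ (ι b * ι z) = φ (x * ι z)

open Classical in
/-- The trace-preserving conditional expectation of `A` onto its subalgebra `ι(B)`. -/
def condExpOnto (φ : A →ₚ[ℂ] ℂ) (ι : B →⋆ₐ[ℂ] A) (x : A) : B :=
  if h : ∃ b, IsCondExp φ ι x b then h.choose else 0

/-- The GNS vector of a state. -/
def gnsVector (φ : A →ₚ[ℂ] ℂ) : φ.GNS := ((φ.toPreGNS 1 : φ.PreGNS) : φ.GNS)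

end States

/-! ### Inclusions and the Jones tower -/

/-- A unital inclusion `N ⊆ M` of finite von Neumann algebras with a faithful normal tracial
state `τ` on `M`, where `M` is represented on `H = L²(M, τ)` by left multiplication:
`Ω` is the cyclic vector and `τ(x) = ⟨xΩ, Ω⟩`. -/
structure TracialInclusion (H : Type*) [NormedAddCommGroup H] [InnerProductSpace ℂ H]
    [CompleteSpace H] where
  M : VonNeumannAlgebra H
  N : VonNeumannAlgebra H
  le : N ≤ M
  Ω : H
  norm_Ω : ‖Ω‖ = 1
  cyclic : Dense ((fun x : H →L[ℂ] H => x Ω) '' (M : Set (H →L[ℂ] H)))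
  trace : ∀ x ∈ M, ∀ y ∈ M, ⟪Ω, (x * y) Ω⟫_ℂ = ⟪Ω, (y * x) Ω⟫_ℂ

namespace TracialInclusion

variable {H : Type*} [NormedAddCommGroup H] [InnerProductSpace ℂ H] [CompleteSpace H]
variable (T : TracialInclusion H)

/-- The trace `τ` on `M`. -/
def τ (x : T.M) : ℂ := ⟪T.Ω, (x : H →L[ℂ] H) T.Ω⟫_ℂ

/-- The elements of `N`, as a subset of `M`. -/
def NinM : Set T.M := {x | (x : H →L[ℂ] H) ∈ T.N}

/-- The modular conjugation `J` on `L²(M)`, `J(xΩ) = x⋆Ω`. -/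
def J : H →SL[starRingEnd ℂ] H := modularConjugation T.M.rep T.Ω

/-- The first Jones projection, from `L²(M)` onto `L²(N)`, as an operator. -/
def e₁op : H →L[ℂ] H := jonesProjection T.M.rep T.Ω T.NinM

/-- The basic construction `M₁ = ⟨M, e₁⟩` on `L²(M)`. -/
def M₁ : VonNeumannAlgebra H :=
  VonNeumannAlgebra.generatedBy ((T.M : Set (H →L[ℂ] H)) ∪ {T.e₁op})

/-- The first Jones projection as an element of `M₁`. -/
def e₁ : T.M₁ :=
  ⟨T.e₁op, VonNeumannAlgebra.subset_generatedBy _ (Or.inr rfl)⟩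

/-- The inclusion of `M` into `M₁`. -/
def ι₀ : T.M →⋆ₐ[ℂ] T.M₁ where
  toFun x := ⟨x, VonNeumannAlgebra.subset_generatedBy _ (Or.inl x.2)⟩
  map_one' := rfl
  map_mul' _ _ := rfl
  map_zero' := rfl
  map_add' _ _ := rfl
  commutes' _ := rfl
  map_star' _ := rfl

end TracialInclusion

/-- An (extremal) `lam`-extension `(M₁, τ₁)` of `N ⊆ M`: a faithful normal trace `τ₁` on `M₁`
extending `τ`, with `E_M(e₁) = lam`, and with `τ₁(x) = τ₁(J x⋆ J)` for `x ∈ N' ∩ M`. -/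
structure LambdaExtension {H : Type*} [NormedAddCommGroup H] [InnerProductSpace ℂ H]
    [CompleteSpace H] (T : TracialInclusion H) where
  lam : ℝ
  lam_pos : 0 < lam
  τ₁ : T.M₁ →ₚ[ℂ] ℂ
  isTrace : IsFaithfulNormalTrace τ₁
  extends_τ : ∀ x : T.M, τ₁ (T.ι₀ x) = T.τ x
  expectation : IsCondExp τ₁ T.ι₀ T.e₁ (algebraMap ℂ T.M (lam : ℂ))
  extremal : ∀ x : T.M, (x : H →L[ℂ] H) ∈ T.N.commutant → ∀ y : T.M₁,
    (y : H →L[ℂ] H) = (T.J.comp (star (x : H →L[ℂ] H))).comp T.J → τ₁ y = τ₁ (T.ι₀ x)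

namespace LambdaExtension

variable {H : Type*} [NormedAddCommGroup H] [InnerProductSpace ℂ H] [CompleteSpace H]
variable {T : TracialInclusion H} (E : LambdaExtension T)

/-- The Hilbert space `L²(M₁, τ₁)`. -/
abbrev L2 : Type _ := E.τ₁.GNS

/-- The action of `M₁` on `L²(M₁, τ₁)` by left multiplication. -/
def π₁ : T.M₁ →⋆ₐ[ℂ] (E.L2 →L[ℂ] E.L2) := E.τ₁.gnsStarAlgHom

/-- The cyclic vector of `L²(M₁, τ₁)`. -/
def Ω₁ : E.L2 := gnsVector E.τ₁

/-- The modular conjugation `J₁` on `L²(M₁, τ₁)`. -/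
def J₁ : E.L2 →SL[starRingEnd ℂ] E.L2 := modularConjugation E.π₁ E.Ω₁

/-- The second Jones projection, from `L²(M₁)` onto `L²(M)`, as an operator. -/
def e₂op : E.L2 →L[ℂ] E.L2 := jonesProjection E.π₁ E.Ω₁ (Set.range T.ι₀)

/-- The basic construction `M₂ = ⟨M₁, e₂⟩` on `L²(M₁, τ₁)`. -/
def M₂ : VonNeumannAlgebra E.L2 :=
  VonNeumannAlgebra.generatedBy (Set.range E.π₁ ∪ {E.e₂op})

/-- The second Jones projection as an element of `M₂`. -/
def e₂ : E.M₂ :=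
  ⟨E.e₂op, VonNeumannAlgebra.subset_generatedBy _ (Or.inr rfl)⟩

/-- The inclusion of `M₁` into `M₂`. -/
def ι₁ : T.M₁ →⋆ₐ[ℂ] E.M₂ where
  toFun x := ⟨E.π₁ x, VonNeumannAlgebra.subset_generatedBy _ (Or.inl ⟨x, rfl⟩)⟩
  map_one' := Subtype.ext (map_one E.π₁)
  map_mul' x y := Subtype.ext (map_mul E.π₁ x y)
  map_zero' := Subtype.ext (map_zero E.π₁)
  map_add' x y := Subtype.ext (map_add E.π₁ x y)
  commutes' c := Subtype.ext (AlgHomClass.commutes E.π₁ c)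
  map_star' x := Subtype.ext (map_star E.π₁ x)

/-- The inclusion of `M` into `M₂`. -/
def ι₂ : T.M →⋆ₐ[ℂ] E.M₂ := E.ι₁.comp T.ι₀

/-- The relative commutant `M' ∩ M₂`. -/
def relCommutant : Set E.M₂ := {y | ∀ x : T.M, E.ι₂ x * y = y * E.ι₂ x}

/-- The contragredient `y ↦ J₁ y⋆ J₁`. -/
def contragredient (y : E.L2 →L[ℂ] E.L2) : E.L2 →L[ℂ] E.L2 :=
  (E.J₁.comp (star y)).comp E.J₁

/-- `y ∈ M' ∩ M₂` is the Fourier multiplier of the `N`-bimodule map `Φ`: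
`⟨y x₁e₁y₁Ω₁, x₂e₁y₂Ω₁⟩ = lam^{3/2} τ(y₂⋆ Φ(x₂⋆ x₁) y₁)`
(here the inner product on the left is linear in its first argument; Mathlib's inner product
is linear in the second one). -/
def IsFourierMultiplier (Φ : T.M → T.M) (y : E.M₂) : Prop :=
  y ∈ E.relCommutant ∧ ∀ x₁ x₂ y₁ y₂ : T.M,
    ⟪E.π₁ (T.ι₀ x₂ * T.e₁ * T.ι₀ y₂) E.Ω₁,
      (y : E.L2 →L[ℂ] E.L2) (E.π₁ (T.ι₀ x₁ * T.e₁ * T.ι₀ y₁) E.Ω₁)⟫_ℂ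
      = ((E.lam ^ (3 / 2 : ℝ) : ℝ) : ℂ) * T.τ (star y₂ * Φ (star x₂ * x₁) * y₁)

open Classical in
/-- The Fourier multiplier of an `N`-bimodule map. -/
def fourierMultiplier (Φ : T.M → T.M) : E.M₂ :=
  if h : ∃ y, E.IsFourierMultiplier Φ y then h.choose else 0

end LambdaExtension

/-- The part `N ⊆ M ⊆ M₁ ⊆ M₂` of the Jones tower: a `lam`-extension `(M₁, τ₁)` of `N ⊆ M`
together with a faithful normal trace `τ₂` on `M₂` making `(M₂, τ₂)` a `lam`-extension of
`M ⊆ M₁`, i.e. `τ₂` extends `τ₁` and `E_{M₁}(e₂) = lam`. -/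
structure JonesTower {H : Type*} [NormedAddCommGroup H] [InnerProductSpace ℂ H]
    [CompleteSpace H] (T : TracialInclusion H) extends LambdaExtension T where
  τ₂ : toLambdaExtension.M₂ →ₚ[ℂ] ℂ
  isTrace₂ : IsFaithfulNormalTrace τ₂
  extends_τ₁ : ∀ x : T.M₁, τ₂ (toLambdaExtension.ι₁ x) = τ₁ x
  expectation₂ : IsCondExp τ₂ toLambdaExtension.ι₁ toLambdaExtension.e₂
    (algebraMap ℂ T.M₁ (lam : ℂ))

/-! ### Bimodule quantum Markov semigroups -/

open scoped CStarAlgebra in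
/-- A (norm continuous) `N`-bimodule quantum Markov semigroup on `M`. -/
structure IsBimoduleQMS {H : Type*} [NormedAddCommGroup H] [InnerProductSpace ℂ H]
    [CompleteSpace H] (T : TracialInclusion H) (Φ : ℝ≥0 → (T.M →L[ℂ] T.M)) : Prop where
  continuous : Continuous Φ
  zero : Φ 0 = ContinuousLinearMap.id ℂ T.M
  add : ∀ s t, Φ (s + t) = (Φ s).comp (Φ t)
  unital : ∀ t, Φ t 1 = 1
  completelyPositive : ∀ t, ∃ ψ : T.M →CP T.M, ∀ x, ψ x = Φ t x
  normal : ∀ t, ScottContinuous (Φ t)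
  bimodule : ∀ t, ∀ a ∈ T.NinM, ∀ b ∈ T.NinM, ∀ x, Φ t (a * x * b) = a * Φ t x * b

section Semigroup

variable {H : Type*} [NormedAddCommGroup H] [InnerProductSpace ℂ H] [CompleteSpace H]
variable {T : TracialInclusion H}

/-- `L` is the (bounded) generator of the semigroup, with the sign convention
`Φ_t = exp(-tL)`. -/
def IsGenerator (Φ : ℝ≥0 → (T.M →L[ℂ] T.M)) (L : T.M →L[ℂ] T.M) : Prop :=
  ∀ t : ℝ≥0, Φ t = NormedSpace.exp ((-((t : ℝ) : ℂ)) • L)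

/-- The gradient form `Γ(x, y) = (y⋆ L(x) + L(y)⋆ x - L(y⋆ x)) / 2`. -/
def gradientForm (L : T.M →L[ℂ] T.M) (x y : T.M) : T.M :=
  (1 / 2 : ℂ) • (star y * L x + star (L y) * x - L (star y * x))

/-- The fixed points of a family of maps. -/
def fixedPoints (Ψ : ℝ≥0 → T.M → T.M) : Set T.M := {x | ∀ t, Ψ t x = x}

/-- The multiplicative domain of a family of maps. -/
def multiplicativeDomain (Ψ : ℝ≥0 → T.M → T.M) : Set T.M :=
  {x | ∀ t, Ψ t (star x) * Ψ t x = Ψ t (star x * x) ∧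
    Ψ t x * Ψ t (star x) = Ψ t (x * star x)}

/-- A map is equilibrium if it preserves some faithful normal state. -/
def IsEquilibrium (Ψ : T.M → T.M) : Prop :=
  ∃ ρ : T.M →ₚ[ℂ] ℂ, IsFaithfulNormalState ρ ∧ ∀ x, ρ (Ψ x) = ρ x

end Semigroup

namespace JonesTower

variable {H : Type*} [NormedAddCommGroup H] [InnerProductSpace ℂ H] [CompleteSpace H]
variable {T : TracialInclusion H} (E : JonesTower T)

/-- The conditional expectation `E_M` of `M₂` onto `M`. -/
def expM (y : E.M₂) : T.M := condExpOnto E.τ₂ E.ι₂ y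

/-- `x * y = lam^{-5/2} E_M(e₂ e₁ y x e₁ e₂)` for `x ∈ M` and `y ∈ M' ∩ M₂`. -/
def convolve (x : T.M) (y : E.M₂) : T.M :=
  ((E.lam ^ (-5 / 2 : ℝ) : ℝ) : ℂ) •
    E.expM (E.e₂ * E.ι₁ T.e₁ * y * E.ι₂ x * E.ι₁ T.e₁ * E.e₂)

/-- The component `-(1 - e₂) L̂ (1 - e₂)` of the Fourier multiplier of the generator. -/
def Lhat₀ (L : T.M →L[ℂ] T.M) : E.M₂ :=
  -((1 - E.e₂) * E.fourierMultiplier L * (1 - E.e₂))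

/-- The Laplacian `L_a(x) = (1 * L̂₀) x / 2 + x (1 * L̂₀) / 2 - x * L̂₀`. -/
def laplacian (L : T.M →L[ℂ] T.M) (x : T.M) : T.M :=
  (1 / 2 : ℂ) • (E.convolve 1 (E.Lhat₀ L) * x) + (1 / 2 : ℂ) • (x * E.convolve 1 (E.Lhat₀ L))
    - E.convolve x (E.Lhat₀ L)

/-- The semigroup `exp(-t L_a)` generated by the Laplacian, as a power series in `L_a`. -/
def laplacianSemigroup (L : T.M →L[ℂ] T.M) (t : ℝ≥0) (x : T.M) : T.M :=
  ∑' n : ℕ, ((-((t : ℝ) : ℂ)) ^ n / (n.factorial : ℂ)) • (E.laplacian L)^[n] x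

/-- Bimodule KMS symmetry, with respect to `Δ`, of the semigroup generated by `L`. -/
structure IsBimoduleKMSSymmetric (L : T.M →L[ℂ] T.M) (Δ : E.M₂) : Prop where
  mem_relCommutant : Δ ∈ E.relCommutant
  strictlyPositive : IsStrictlyPositive (Δ : E.L2 →L[ℂ] E.L2)
  mul_e₂ : Δ * E.e₂ = E.e₂
  range_mul :
    rangeProjection (E.fourierMultiplier L : E.L2 →L[ℂ] E.L2) *
        E.contragredient (Δ : E.L2 →L[ℂ] E.L2)
      = rangeProjection (E.fourierMultiplier L : E.L2 →L[ℂ] E.L2) *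
        Ring.inverse (Δ : E.L2 →L[ℂ] E.L2)
  symmetric :
    E.contragredient (E.fourierMultiplier L : E.L2 →L[ℂ] E.L2)
      = E.contragredient (Δ : E.L2 →L[ℂ] E.L2) * (E.fourierMultiplier L : E.L2 →L[ℂ] E.L2) *
        E.contragredient (Δ : E.L2 →L[ℂ] E.L2)
  equilibrium : ∀ t, IsEquilibrium (E.laplacianSemigroup L t)

/-- Relative ergodicity of the semigroup generated by `L`: `L̂₀` and its contragredient have the
same range projection, and the fixed point space of `exp(-t L_a)` is `N`. -/
structure IsRelativelyErgodic (L : T.M →L[ℂ] T.M) : Prop where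
  range_eq : rangeProjection (E.contragredient (E.Lhat₀ L : E.L2 →L[ℂ] E.L2))
    = rangeProjection (E.Lhat₀ L : E.L2 →L[ℂ] E.L2)
  fixedPoints_eq : fixedPoints (E.laplacianSemigroup L) = T.NinM

end JonesTower

end

open scoped InnerProductSpace ComplexOrder NNReal

noncomputable section

/-! ### Cyclic trace vectors -/

section TraceVector

variable {A : Type*} [CStarAlgebra A]
variable {K : Type*} [NormedAddCommGroup K] [InnerProductSpace ℂ K] [CompleteSpace K]

/-! Everything is read off the commutator vectors ξ_x = (x e₁ - e₁ x)Ω₁ (`commVec`), which are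
orthogonal to L²(M) and satisfy J₁ ξ_x = -ξ_{x⋆}. If F has Fourier multiplier y, then ⟨ξ_x, y ξ_x⟩
is lam^{3/2} τ(F(x⋆x) - x⋆F(x) - F(x⋆)x + x⋆F(1)x) (`IsFourierMultiplier.inner_commVec`). For F = L
this is a negative multiple of τ(Γ(x, x)); for F = (· * L̂₀) it is a positive multiple of the trace
of the carré du champ of the Laplacian.

Complete positivity makes L conditionally negative, and hence L̂₀ ≥ 0 (`JonesTower.Lhat₀_nonneg`).
So the vanishing of either form at ξ_x forces L̂₀ ξ_x = 0. If L̂₀ kills both ξ_x and ξ_{x⋆}, then x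
* L̂₀ equals both (1 * L̂₀)x and x(1 * L̂₀), so that L_a(x) = 0; then x is fixed by the semigroup,
and relative ergodicity puts it in N.

An x in the multiplicative domain gives both conditions, by differentiating the two multiplicativity
identities at t = 0. If Γ(x, x) = 0 only ξ_x is controlled at first; equality of the range
projections of L̂₀ and its contragredient makes ker L̂₀ invariant under J₁, which supplies ξ_{x⋆}.
Conversely, elements of N commute with e₁, and L is an N-bimodule map with L(1) = 0, so N lies in
all the sets.

The analytic cost is in two facts. Positivity on all of L²(M)^⊥ needs M e₁ M Ω₁ to be total in
L²(M₁) (`dense_cornerSpace`), which rests on e₁ M₁ e₁ = N e₁, on M₁ e₁ = M e₁ and on normality of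
τ₁. And y must be the multiplier of x ↦ x * y (`isFourierMultiplier_convolve`), which comes from
compressing operators on L²(M₁) to L²(M). -/

/-- An orthogonal projection commutes with every operator which leaves its range invariant
together with its adjoint. -/
theorem commute_starProjection {V : Submodule ℂ K} [V.HasOrthogonalProjection] {R : K →L[ℂ] K}
    (h : ∀ v ∈ V, R v ∈ V) (h' : ∀ v ∈ V, star R v ∈ V) : Commute V.starProjection R := by
  ext v
  change V.starProjection (R v) = R (V.starProjection v)
  refine (Submodule.eq_starProjection_of_mem_of_inner_eq_zero
    (h _ (V.starProjection_apply_mem v)) fun w hw => ?_)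
  rw [← map_sub, ← ContinuousLinearMap.adjoint_inner_right, ← ContinuousLinearMap.star_eq_adjoint]
  exact Submodule.starProjection_inner_eq_zero _ _ (h' w hw)

theorem mapsTo_closure_span {K : Type*} [NormedAddCommGroup K] [InnerProductSpace ℂ K]
    {S : Set K} {R : K →L[ℂ] K}
    (h : ∀ v ∈ S, R v ∈ (Submodule.span ℂ S).topologicalClosure) :
    ∀ v ∈ (Submodule.span ℂ S).topologicalClosure,
      R v ∈ (Submodule.span ℂ S).topologicalClosure := by
  intro v hv
  have h1 : Submodule.span ℂ S ≤
      ((Submodule.span ℂ S).topologicalClosure).comap (R : K →ₗ[ℂ] K) :=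
    Submodule.span_le.2 h
  have h2 : IsClosed ((((Submodule.span ℂ S).topologicalClosure).comap
      (R : K →ₗ[ℂ] K) : Submodule ℂ K) : Set K) :=
    (Submodule.isClosed_topologicalClosure _).preimage R.continuous
  exact Submodule.topologicalClosure_minimal _ h1 h2 hv

theorem commute_starProjection_closure_span {S : Set K} {R : K →L[ℂ] K}
    (h : ∀ v ∈ S, R v ∈ (Submodule.span ℂ S).topologicalClosure)
    (h' : ∀ v ∈ S, star R v ∈ (Submodule.span ℂ S).topologicalClosure) :
    Commute (Submodule.span ℂ S).topologicalClosure.starProjection R :=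
  commute_starProjection (mapsTo_closure_span h) (mapsTo_closure_span h')

theorem orbitMap_apply (π : A →⋆ₐ[ℂ] (K →L[ℂ] K)) (ξ : K) (x : A) : orbitMap π ξ x = π x ξ := rfl

/-- A cyclic vector which defines a trace. -/
structure IsTraceVector (π : A →⋆ₐ[ℂ] (K →L[ℂ] K)) (ξ : K) : Prop where
  dense : DenseRange (orbitMap π ξ)
  trace : ∀ x y, ⟪ξ, π (x * y) ξ⟫_ℂ = ⟪ξ, π (y * x) ξ⟫_ℂ

theorem inner_star_apply (π : A →⋆ₐ[ℂ] (K →L[ℂ] K)) (x : A) (u v : K) :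
    ⟪π (star x) u, v⟫_ℂ = ⟪u, π x v⟫_ℂ := by
  rw [map_star, ContinuousLinearMap.star_eq_adjoint, ContinuousLinearMap.adjoint_inner_left]

theorem apply_apply (π : A →⋆ₐ[ℂ] (K →L[ℂ] K)) (x y : A) (v : K) :
    π x (π y v) = π (x * y) v := by
  rw [map_mul]; rfl

theorem inner_apply_star (π : A →⋆ₐ[ℂ] (K →L[ℂ] K)) (x : A) (u v : K) :
    ⟪π x u, v⟫_ℂ = ⟪u, π (star x) v⟫_ℂ := by
  rw [← inner_star_apply, star_star]

namespace IsTraceVector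

variable {π : A →⋆ₐ[ℂ] (K →L[ℂ] K)} {ξ : K} (h : IsTraceVector π ξ)
include h

theorem inner_orbit (x y : A) : ⟪π x ξ, π y ξ⟫_ℂ = ⟪π (star y) ξ, π (star x) ξ⟫_ℂ := by
  rw [inner_apply_star, inner_star_apply, apply_apply, h.trace, apply_apply]

theorem norm_orbit_star (x : A) : ‖π (star x) ξ‖ = ‖π x ξ‖ := by
  have := h.inner_orbit x x
  rw [inner_self_eq_norm_sq_to_K, inner_self_eq_norm_sq_to_K] at this
  have h2 : ‖π x ξ‖ ^ 2 = ‖π (star x) ξ‖ ^ 2 := by exact_mod_cast this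
  exact ((sq_eq_sq₀ (norm_nonneg _) (norm_nonneg _)).1 h2).symm

theorem modularConjugation_apply (x : A) :
    modularConjugation π ξ (π x ξ) = π (star x) ξ :=
  LinearMap.extendOfNorm_eq h.dense ⟨1, fun y => by
    rw [one_mul]; exact (h.norm_orbit_star y).le⟩ x

/-- Two continuous maps which agree on the orbit of a cyclic vector agree. -/
theorem eq_of_orbit {F : Type*} [TopologicalSpace F] [T2Space F] {f g : K → F}
    (hf : Continuous f) (hg : Continuous g) (hfg : ∀ x, f (π x ξ) = g (π x ξ)) (v : K) :
    f v = g v :=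
  congrFun (h.dense.equalizer hf hg (funext hfg)) v

theorem modularConjugation_involutive (v : K) :
    modularConjugation π ξ (modularConjugation π ξ v) = v := by
  refine h.eq_of_orbit (f := fun v => modularConjugation π ξ (modularConjugation π ξ v))
    (by fun_prop) continuous_id (fun x => ?_) v
  simp [h.modularConjugation_apply]

theorem inner_modularConjugation (u v : K) :
    ⟪modularConjugation π ξ u, modularConjugation π ξ v⟫_ℂ = ⟪v, u⟫_ℂ := by
  refine h.eq_of_orbit (f := fun u => ⟪modularConjugation π ξ u, modularConjugation π ξ v⟫_ℂ)
    (g := fun u => ⟪v, u⟫_ℂ) (by fun_prop) (by fun_prop) (fun x => ?_) u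
  refine h.eq_of_orbit
    (f := fun v => ⟪modularConjugation π ξ (π x ξ), modularConjugation π ξ v⟫_ℂ)
    (g := fun v => ⟪v, π x ξ⟫_ℂ) (by fun_prop) (by fun_prop) (fun y => ?_) v
  rw [h.modularConjugation_apply, h.modularConjugation_apply, ← h.inner_orbit]

theorem inner_modularConjugation_left (u v : K) :
    ⟪modularConjugation π ξ u, v⟫_ℂ = ⟪modularConjugation π ξ v, u⟫_ℂ := by
  conv_lhs => rw [← h.modularConjugation_involutive v]
  exact h.inner_modularConjugation _ _

end IsTraceVector

/-- The conjugate `J T J` of a bounded operator by the modular conjugation. -/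
def conjOp (π : A →⋆ₐ[ℂ] (K →L[ℂ] K)) (ξ : K) (S : K →L[ℂ] K) : K →L[ℂ] K :=
  ((modularConjugation π ξ).comp S).comp (modularConjugation π ξ)

theorem conjOp_apply (π : A →⋆ₐ[ℂ] (K →L[ℂ] K)) (ξ : K) (S : K →L[ℂ] K) (v : K) :
    conjOp π ξ S v = modularConjugation π ξ (S (modularConjugation π ξ v)) := rfl

/-- Right multiplication by an algebra element on the space of a cyclic trace vector. -/
def rightMul (π : A →⋆ₐ[ℂ] (K →L[ℂ] K)) (ξ : K) (z : A) : K →L[ℂ] K :=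
  conjOp π ξ (π (star z))

namespace IsTraceVector

variable {π : A →⋆ₐ[ℂ] (K →L[ℂ] K)} {ξ : K} (h : IsTraceVector π ξ)
include h

theorem conjOp_conjOp (S : K →L[ℂ] K) : conjOp π ξ (conjOp π ξ S) = S := by
  ext v
  simp [conjOp_apply, h.modularConjugation_involutive]

theorem conjOp_mul (S R : K →L[ℂ] K) : conjOp π ξ (S * R) = conjOp π ξ S * conjOp π ξ R := by
  ext v
  simp [conjOp_apply, h.modularConjugation_involutive]

theorem conjOp_star (S : K →L[ℂ] K) : conjOp π ξ (star S) = star (conjOp π ξ S) := by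
  rw [ContinuousLinearMap.star_eq_adjoint, ContinuousLinearMap.star_eq_adjoint,
    ContinuousLinearMap.eq_adjoint_iff]
  intro u v
  rw [conjOp_apply, conjOp_apply, h.inner_modularConjugation_left,
    ContinuousLinearMap.adjoint_inner_right]
  conv_lhs => rw [← h.modularConjugation_involutive (S (modularConjugation π ξ v))]
  exact h.inner_modularConjugation _ _

theorem rightMul_orbit (z x : A) : rightMul π ξ z (π x ξ) = π (x * z) ξ := by
  rw [rightMul, conjOp_apply, h.modularConjugation_apply, apply_apply,
    h.modularConjugation_apply]
  simp

theorem star_rightMul (z : A) : star (rightMul π ξ z) = rightMul π ξ (star z) := by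
  rw [rightMul, rightMul, ← h.conjOp_star, map_star π (star z)]

theorem commute_rightMul (z x : A) : Commute (π x) (rightMul π ξ z) := by
  ext v
  refine h.eq_of_orbit (f := fun v => (π x * rightMul π ξ z) v)
    (g := fun v => (rightMul π ξ z * π x) v) (by fun_prop) (by fun_prop) (fun y => ?_) v
  change π x (rightMul π ξ z (π y ξ)) = rightMul π ξ z (π x (π y ξ))
  rw [h.rightMul_orbit, apply_apply, apply_apply, h.rightMul_orbit, mul_assoc]

theorem rightMul_vec (z : A) : rightMul π ξ z ξ = π z ξ := by
  simpa using h.rightMul_orbit z 1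

/-- A cyclic trace vector is separating for the commutant of right multiplications. -/
theorem eq_zero_of_commute {S : K →L[ℂ] K} (hS : ∀ z, Commute S (rightMul π ξ z))
    (h0 : S ξ = 0) : S = 0 := by
  ext v
  refine h.eq_of_orbit (f := fun v => S v) (g := fun v => (0 : K →L[ℂ] K) v)
    (by fun_prop) (by fun_prop) (fun y => ?_) v
  have := congrArg (fun R : K →L[ℂ] K => R ξ) (hS y).eq
  simpa [h.rightMul_vec, h0] using this

theorem eq_of_commute {S R : K →L[ℂ] K} (hS : ∀ z, Commute S (rightMul π ξ z))
    (hR : ∀ z, Commute R (rightMul π ξ z)) (h0 : S ξ = R ξ) : S = R :=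
  sub_eq_zero.1 (h.eq_zero_of_commute (fun z => (hS z).sub_left (hR z)) (by simp [h0]))

end IsTraceVector

/-! ### The Jones projection of a subalgebra -/

section Jones

variable {π : A →⋆ₐ[ℂ] (K →L[ℂ] K)} {ξ : K} {B : Set A}

theorem jonesProjection_orbit {b : A} (hb : b ∈ B) :
    jonesProjection π ξ B (π b ξ) = π b ξ :=
  Submodule.starProjection_eq_self_iff.2
    (Submodule.le_topologicalClosure _ (Submodule.subset_span ⟨b, hb, rfl⟩))

theorem jonesProjection_isSelfAdjoint : IsSelfAdjoint (jonesProjection π ξ B) :=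
  isSelfAdjoint_starProjection _

theorem jonesProjection_mul_self :
    jonesProjection π ξ B * jonesProjection π ξ B = jonesProjection π ξ B :=
  Submodule.isIdempotentElem_starProjection _

theorem commute_jonesProjection_apply (hmul : ∀ a ∈ B, ∀ b ∈ B, a * b ∈ B)
    (hstar : ∀ a ∈ B, star a ∈ B) {a : A} (ha : a ∈ B) : Commute (jonesProjection π ξ B) (π a) := by
  refine commute_starProjection_closure_span ?_ ?_
  · rintro _ ⟨b, hb, rfl⟩
    refine Submodule.le_topologicalClosure _ (Submodule.subset_span ⟨a * b, hmul _ ha _ hb, ?_⟩)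
    simp
  · rintro _ ⟨b, hb, rfl⟩
    refine Submodule.le_topologicalClosure _
      (Submodule.subset_span ⟨star a * b, hmul _ (hstar _ ha) _ hb, ?_⟩)
    simp [map_star]

theorem IsTraceVector.commute_jonesProjection_rightMul (h : IsTraceVector π ξ)
    (hmul : ∀ a ∈ B, ∀ b ∈ B, a * b ∈ B)
    (hstar : ∀ a ∈ B, star a ∈ B) {a : A} (ha : a ∈ B) :
    Commute (jonesProjection π ξ B) (rightMul π ξ a) := by
  refine commute_starProjection_closure_span ?_ ?_
  · rintro _ ⟨b, hb, rfl⟩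
    refine Submodule.le_topologicalClosure _ (Submodule.subset_span ⟨b * a, hmul _ hb _ ha, ?_⟩)
    simp only [h.rightMul_orbit]
  · rintro _ ⟨b, hb, rfl⟩
    refine Submodule.le_topologicalClosure _
      (Submodule.subset_span ⟨b * star a, hmul _ hb _ (hstar _ ha), ?_⟩)
    simp only [h.star_rightMul, h.rightMul_orbit]

/-- Two bounded operators which agree on the orbit of a linear subspace agree on the range of its
Jones projection. -/
theorem mul_jonesProjection_eq {S R : K →L[ℂ] K} (hSR : ∀ b ∈ B, S (π b ξ) = R (π b ξ)) :
    S * jonesProjection π ξ B = R * jonesProjection π ξ B := by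
  ext v
  have h1 : Submodule.span ℂ ((fun b => π b ξ) '' B) ≤
      LinearMap.eqLocus (S : K →ₗ[ℂ] K) (R : K →ₗ[ℂ] K) := by
    refine Submodule.span_le.2 ?_
    rintro _ ⟨b, hb, rfl⟩
    exact hSR b hb
  exact Submodule.topologicalClosure_minimal _ h1 (isClosed_eq S.continuous R.continuous)
    (Submodule.starProjection_apply_mem _ v)

/-- A vector in the range of the Jones projection is determined by its inner products with the
orbit. -/
theorem eq_of_inner_orbit {u v : K} (hu : jonesProjection π ξ B u = u)
    (hv : jonesProjection π ξ B v = v) (huv : ∀ b ∈ B, ⟪π b ξ, u⟫_ℂ = ⟪π b ξ, v⟫_ℂ) : u = v := by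
  have hz : ∀ b ∈ B, ⟪u - v, π b ξ⟫_ℂ = 0 := fun b hb => by
    rw [← inner_conj_symm, inner_sub_right, huv b hb, sub_self, map_zero]
  have h0 : innerSL ℂ (u - v) ∘L jonesProjection π ξ B = 0 := by
    ext w
    have h1 : Submodule.span ℂ ((fun b => π b ξ) '' B) ≤
        LinearMap.ker (innerSL ℂ (u - v) : K →ₗ[ℂ] ℂ) := by
      refine Submodule.span_le.2 ?_
      rintro _ ⟨b, hb, rfl⟩
      exact hz b hb
    exact Submodule.topologicalClosure_minimal _ h1
      (isClosed_eq (innerSL ℂ (u - v)).continuous continuous_const)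
      (Submodule.starProjection_apply_mem _ w)
  have h2 := congrArg (fun f : K →L[ℂ] ℂ => f (u - v)) h0
  have hP : jonesProjection π ξ B (u - v) = u - v := by rw [map_sub, hu, hv]
  rw [ContinuousLinearMap.comp_apply, hP] at h2
  exact sub_eq_zero.1 (inner_self_eq_zero.1 h2)

/-- J permutes the orbit of a star-closed set, hence preserves its closed span. -/
theorem IsTraceVector.conjOp_jonesProjection (h : IsTraceVector π ξ)
    (hstar : ∀ a ∈ B, star a ∈ B) :
    conjOp π ξ (jonesProjection π ξ B) = jonesProjection π ξ B := by
  have key : ∀ v, jonesProjection π ξ B v = v →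
      jonesProjection π ξ B (modularConjugation π ξ v) = modularConjugation π ξ v := by
    intro v hv
    have h1 : Submodule.span ℂ ((fun b => π b ξ) '' B) ≤
        ((Submodule.span ℂ ((fun b => π b ξ) '' B)).topologicalClosure).comap
          (modularConjugation π ξ : K →ₛₗ[starRingEnd ℂ] K) := by
      refine Submodule.span_le.2 ?_
      rintro _ ⟨b, hb, rfl⟩
      refine Submodule.le_topologicalClosure _ (Submodule.subset_span ⟨star b, hstar b hb, ?_⟩)
      exact (h.modularConjugation_apply b).symm
    exact Submodule.starProjection_eq_self_iff.2 (Submodule.topologicalClosure_minimal _ h1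
      ((Submodule.isClosed_topologicalClosure _).preimage (modularConjugation π ξ).continuous)
      (Submodule.starProjection_eq_self_iff.1 hv))
  have hPP : ∀ v, jonesProjection π ξ B (jonesProjection π ξ B v) = jonesProjection π ξ B v :=
    fun v => congrArg (fun S : K →L[ℂ] K => S v) (jonesProjection_mul_self (π := π) (ξ := ξ) (B := B))
  have hl : jonesProjection π ξ B * conjOp π ξ (jonesProjection π ξ B)
      = conjOp π ξ (jonesProjection π ξ B) := by
    ext v
    exact key _ (hPP _)
  have hl' := congrArg star hl
  rw [star_mul, ← h.conjOp_star, jonesProjection_isSelfAdjoint.star_eq] at hl'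
  have hr : conjOp π ξ (jonesProjection π ξ B) * jonesProjection π ξ B
      = jonesProjection π ξ B := by
    ext v
    change modularConjugation π ξ (jonesProjection π ξ B
      (modularConjugation π ξ (jonesProjection π ξ B v))) = jonesProjection π ξ B v
    rw [key _ (hPP v), h.modularConjugation_involutive]
  exact hl'.symm.trans hr

end Jones

end TraceVector

/-! ### Commutation theorem for the corner of a subalgebra, and reduction by its Jones projection -/

namespace TracialInclusion

variable {H : Type*} [NormedAddCommGroup H] [InnerProductSpace ℂ H] [CompleteSpace H]
variable (T : TracialInclusion H)

theorem isTraceVector : IsTraceVector T.M.rep T.Ω where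
  dense := by
    refine T.cyclic.mono ?_
    rintro _ ⟨x, hx, rfl⟩
    exact ⟨⟨x, hx⟩, rfl⟩
  trace x y := T.trace x x.2 y y.2

/-- The elements of a subalgebra `D`, as a subset of `M`. -/
def elementsOf (D : VonNeumannAlgebra H) : Set T.M := {x | (x : H →L[ℂ] H) ∈ D}

theorem mul_mem_elementsOf (D : VonNeumannAlgebra H) :
    ∀ a ∈ T.elementsOf D, ∀ b ∈ T.elementsOf D, a * b ∈ T.elementsOf D :=
  fun _ ha _ hb => mul_mem (S := VonNeumannAlgebra H) (s := D) ha hb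

theorem star_mem_elementsOf (D : VonNeumannAlgebra H) :
    ∀ a ∈ T.elementsOf D, star a ∈ T.elementsOf D :=
  fun _ ha => star_mem (S := VonNeumannAlgebra H) (s := D) ha

/-- The operators `c = P c P` in the commutant of `D`, where `P` is the Jones projection of `D`. -/
structure IsCorner (D : VonNeumannAlgebra H) (c : H →L[ℂ] H) : Prop where
  left : jonesProjection T.M.rep T.Ω (T.elementsOf D) * c = c
  right : c * jonesProjection T.M.rep T.Ω (T.elementsOf D) = c
  comm : ∀ d ∈ T.elementsOf D, Commute (T.M.rep d) c

variable {T} {D : VonNeumannAlgebra H}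

theorem jonesProjection_vec :
    jonesProjection T.M.rep T.Ω (T.elementsOf D) T.Ω = T.Ω := by
  have := jonesProjection_orbit (π := T.M.rep) (ξ := T.Ω) (B := T.elementsOf D) (b := 1)
    (one_mem D)
  simpa using this

namespace IsCorner

theorem star {c : H →L[ℂ] H} (hc : T.IsCorner D c) : T.IsCorner D (star c) where
  left := by
    have := congrArg Star.star hc.right
    rwa [star_mul, jonesProjection_isSelfAdjoint.star_eq] at this
  right := by
    have := congrArg Star.star hc.left
    rwa [star_mul, jonesProjection_isSelfAdjoint.star_eq] at this
  comm d hd := by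
    have := (hc.comm _ (T.star_mem_elementsOf D d hd)).star_star
    rwa [map_star, star_star] at this

theorem mul {a b : H →L[ℂ] H} (ha : T.IsCorner D a) (hb : T.IsCorner D b) :
    T.IsCorner D (a * b) where
  left := by rw [← mul_assoc, ha.left]
  right := by rw [mul_assoc, hb.right]
  comm d hd := (ha.comm d hd).mul_right (hb.comm d hd)

theorem rightMul_jonesProjection {d : T.M} (hd : d ∈ T.elementsOf D) :
    T.IsCorner D (rightMul T.M.rep T.Ω d * jonesProjection T.M.rep T.Ω (T.elementsOf D)) where
  left := by
    rw [← mul_assoc, (T.isTraceVector.commute_jonesProjection_rightMul (T.mul_mem_elementsOf D)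
      (T.star_mem_elementsOf D) hd).eq, mul_assoc, jonesProjection_mul_self]
  right := by rw [mul_assoc, jonesProjection_mul_self]
  comm y hy := (T.isTraceVector.commute_rightMul _ _).mul_right
    (commute_jonesProjection_apply (T.mul_mem_elementsOf D) (T.star_mem_elementsOf D) hy).symm

/-- Both vectors lie in the range of P, so it suffices to pair them with bΩ for b ∈ D; there the
identity is the fact that c commutes with b. Thus J acts on the whole corner of the commutant as it
does on M. -/
theorem modularConjugation_apply {c : H →L[ℂ] H} (hc : T.IsCorner D c) :
    modularConjugation T.M.rep T.Ω (c T.Ω) = Star.star c T.Ω := by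
  have hJ := T.isTraceVector.conjOp_jonesProjection (T.star_mem_elementsOf D)
  have hl := hc.left
  refine eq_of_inner_orbit (π := T.M.rep) (ξ := T.Ω) (B := T.elementsOf D) ?_ ?_ fun b hb => ?_
  · rw [← hJ, conjOp_apply, T.isTraceVector.modularConjugation_involutive,
      ← ContinuousLinearMap.comp_apply]
    exact congrArg (fun S : H →L[ℂ] H => modularConjugation T.M.rep T.Ω (S T.Ω)) hl
  · exact congrArg (fun S : H →L[ℂ] H => S T.Ω) hc.star.left
  · have h1 := T.isTraceVector.inner_modularConjugation (T.M.rep (Star.star b) T.Ω) (c T.Ω)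
    rw [T.isTraceVector.modularConjugation_apply, star_star] at h1
    rw [h1, ContinuousLinearMap.star_eq_adjoint, ContinuousLinearMap.adjoint_inner_right]
    have h2 := congrArg (fun S : H →L[ℂ] H => S T.Ω) (hc.comm b hb).eq
    change T.M.rep b (c T.Ω) = c (T.M.rep b T.Ω) at h2
    rw [← h2, ← inner_apply_star]

/-- The tracial commutation argument: for a corner operator c, both products send cΩ to b c a⋆ Ω, by
repeated use of J(cΩ) = c⋆Ω. -/
theorem commute_conjOp {a b : H →L[ℂ] H} (ha : T.IsCorner D a) (hb : T.IsCorner D b) :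
    Commute (conjOp T.M.rep T.Ω a) b := by
  have hJ := T.isTraceVector.conjOp_jonesProjection (T.star_mem_elementsOf D)
  have h1 : conjOp T.M.rep T.Ω a * b
      = conjOp T.M.rep T.Ω a * b * jonesProjection T.M.rep T.Ω (T.elementsOf D) := by
    rw [mul_assoc, hb.right]
  have h2 : b * conjOp T.M.rep T.Ω a
      = b * conjOp T.M.rep T.Ω a * jonesProjection T.M.rep T.Ω (T.elementsOf D) := by
    conv_rhs => rw [mul_assoc, ← hJ, ← T.isTraceVector.conjOp_mul, ha.right]
  change _ * _ = _ * _
  rw [h1, h2]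
  refine mul_jonesProjection_eq fun d hd => ?_
  -- A corner operator with cΩ = dΩ, so that the formula for J applies to the test vectors dΩ.
  set c := rightMul T.M.rep T.Ω d * jonesProjection T.M.rep T.Ω (T.elementsOf D) with hcdef
  have hc : T.IsCorner D c := rightMul_jonesProjection hd
  have hcΩ : c T.Ω = T.M.rep d T.Ω := by
    change rightMul T.M.rep T.Ω d (jonesProjection T.M.rep T.Ω (T.elementsOf D) T.Ω) = _
    rw [jonesProjection_vec, T.isTraceVector.rightMul_vec]
  rw [← hcΩ]
  change modularConjugation T.M.rep T.Ω (a (modularConjugation T.M.rep T.Ω ((b * c) T.Ω)))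
    = b (modularConjugation T.M.rep T.Ω (a (modularConjugation T.M.rep T.Ω (c T.Ω))))
  rw [(hb.mul hc).modularConjugation_apply, hc.modularConjugation_apply]
  change modularConjugation T.M.rep T.Ω ((a * Star.star (b * c)) T.Ω)
    = b (modularConjugation T.M.rep T.Ω ((a * Star.star c) T.Ω))
  rw [(ha.mul (hb.mul hc).star).modularConjugation_apply,
    (ha.mul hc.star).modularConjugation_apply]
  simp [star_mul]

/-- The compression of an operator commuting with the right multiplications by `D` commutes with
all operators in the corner of the commutant of `D`. -/
theorem commute_compression {a x : H →L[ℂ] H} (ha : T.IsCorner D a)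
    (hx : ∀ d ∈ T.elementsOf D, Commute x (rightMul T.M.rep T.Ω d)) :
    Commute (jonesProjection T.M.rep T.Ω (T.elementsOf D) * x *
      jonesProjection T.M.rep T.Ω (T.elementsOf D)) a := by
  have hJ := T.isTraceVector.conjOp_jonesProjection (T.star_mem_elementsOf D)
  set P := jonesProjection T.M.rep T.Ω (T.elementsOf D) with hP
  have hPP : P * P = P := jonesProjection_mul_self
  -- Conjugation by J turns right multiplications by D into left ones, so J(PxP)J is itself a corner
  -- operator and `commute_conjOp` applies to it.
  have hc : T.IsCorner D (conjOp T.M.rep T.Ω (P * x * P)) := by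
    constructor
    · rw [← hP, ← hJ, ← T.isTraceVector.conjOp_mul, hJ, ← mul_assoc, ← mul_assoc, hPP]
    · rw [← hP, ← hJ, ← T.isTraceVector.conjOp_mul, hJ, mul_assoc, hPP]
    · intro d hd
      have h1 := T.star_mem_elementsOf D d hd
      have h2 : Commute P (rightMul T.M.rep T.Ω (Star.star d)) :=
        T.isTraceVector.commute_jonesProjection_rightMul (T.mul_mem_elementsOf D)
          (T.star_mem_elementsOf D) h1
      have h3 := ((h2.mul_left (hx _ h1)).mul_left h2).symm.eq
      have h4 := congrArg (conjOp T.M.rep T.Ω) h3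
      generalize P * x * P = y at h4 ⊢
      rw [T.isTraceVector.conjOp_mul, T.isTraceVector.conjOp_mul, rightMul,
        T.isTraceVector.conjOp_conjOp, star_star] at h4
      exact h4
  have := hc.commute_conjOp ha
  rwa [T.isTraceVector.conjOp_conjOp] at this

end IsCorner

/-- The commutant of D contains the right multiplications by M, and these already move Ω onto MΩ. -/
theorem denseRange_orbitMap_commutant (hD : D ≤ T.M) :
    DenseRange (orbitMap D.commutant.rep T.Ω) := by
  refine T.isTraceVector.dense.mono ?_
  rintro _ ⟨d, rfl⟩
  refine ⟨⟨rightMul T.M.rep T.Ω d, ?_⟩, T.isTraceVector.rightMul_vec d⟩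
  rw [VonNeumannAlgebra.mem_commutant_iff]
  exact fun g hg => (T.isTraceVector.commute_rightMul d ⟨g, hD hg⟩).eq

/-- Reduction by the Jones projection of a subalgebra `D`: the compression of an operator
commuting with right multiplications by `D` is given by an element of `D`. -/
theorem exists_compression_eq (hD : D ≤ T.M) {x : H →L[ℂ] H}
    (hx : ∀ d ∈ T.elementsOf D, Commute x (rightMul T.M.rep T.Ω d)) :
    ∃ d ∈ T.elementsOf D, jonesProjection T.M.rep T.Ω (T.elementsOf D) * x *
      jonesProjection T.M.rep T.Ω (T.elementsOf D)
        = T.M.rep d * jonesProjection T.M.rep T.Ω (T.elementsOf D) := by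
  set P := jonesProjection T.M.rep T.Ω (T.elementsOf D) with hP
  have hPP : P * P = P := jonesProjection_mul_self
  have hPΩ : P T.Ω = T.Ω := jonesProjection_vec
  have hPs : star P = P := jonesProjection_isSelfAdjoint.star_eq
  have hPd : ∀ d ∈ T.elementsOf D, Commute P (T.M.rep d) := fun d hd =>
    commute_jonesProjection_apply (T.mul_mem_elementsOf D) (T.star_mem_elementsOf D) hd
  set t := P * x * P with ht
  have hPt : P * t = t := by rw [ht, ← mul_assoc, ← mul_assoc, hPP]
  have hdense := denseRange_orbitMap_commutant hD
  -- The required element of D is to be nΩ ↦ n t Ω for n ∈ D'. On the range of P, n has the same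
  -- norms as s = (P n⋆n P)^{1/2}, and s commutes with t, so ‖n t Ω‖ = ‖t s Ω‖ ≤ ‖t‖ ‖nΩ‖.
  have hbound : ∀ n : D.commutant, ‖orbitMap D.commutant.rep (t T.Ω) n‖
      ≤ ‖t‖ * ‖orbitMap D.commutant.rep T.Ω n‖ := by
    intro n
    set m : H →L[ℂ] H := n.1 with hm
    have hn := VonNeumannAlgebra.mem_commutant_iff.1 n.2
    have hns := VonNeumannAlgebra.mem_commutant_iff.1 (star n).2
    set a := P * (star m * m) * P with ha
    have ha0 : 0 ≤ a := by
      have h1 : a = star (m * P) * (m * P) := by rw [star_mul, hPs, ha]; simp only [mul_assoc]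
      rw [h1]
      exact star_mul_self_nonneg _
    have hcorner : T.IsCorner D a := by
      refine ⟨?_, ?_, fun d hd => ?_⟩
      · rw [ha, ← mul_assoc, ← mul_assoc, hPP]
      · rw [ha, mul_assoc, hPP]
      · have h1 : Commute (T.M.rep d) m := hn _ hd
        have h2 : Commute (T.M.rep d) (star m) := hns _ hd
        exact ((hPd d hd).symm.mul_right (h2.mul_right h1)).mul_right (hPd d hd).symm
    have hcomm : Commute t a := hcorner.commute_compression hx
    set s := CFC.sqrt a with hs
    have hss : star s * s = a := by
      rw [(IsSelfAdjoint.of_nonneg (CFC.sqrt_nonneg a)).star_eq, CFC.sqrt_mul_sqrt_self _ ha0]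
    have hst : Commute s t := hcomm.symm.cfcₙ_nnreal NNReal.sqrt
    have key : ∀ v, P v = v → ‖m v‖ = ‖s v‖ := by
      intro v hv
      have h1 : ⟪m v, m v⟫_ℂ = ⟪s v, s v⟫_ℂ := by
        rw [← ContinuousLinearMap.adjoint_inner_right m, ← ContinuousLinearMap.adjoint_inner_right s,
          ← ContinuousLinearMap.star_eq_adjoint, ← ContinuousLinearMap.star_eq_adjoint]
        have h2 : star s (s v) = P (star m (m v)) := by
          change (star s * s) v = _
          rw [hss, ha]
          change P ((star m * m) (P v)) = _
          rw [hv]; rfl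
        rw [h2]
        nth_rw 1 [← hv]
        nth_rw 1 [← hPs]
        rw [ContinuousLinearMap.star_eq_adjoint, ContinuousLinearMap.adjoint_inner_left]
      rw [inner_self_eq_norm_sq_to_K, inner_self_eq_norm_sq_to_K] at h1
      have h2 : ‖m v‖ ^ 2 = ‖s v‖ ^ 2 := by exact_mod_cast h1
      exact (sq_eq_sq₀ (norm_nonneg _) (norm_nonneg _)).1 h2
    change ‖m (t T.Ω)‖ ≤ ‖t‖ * ‖m T.Ω‖
    rw [key (t T.Ω) (congrArg (fun S : H →L[ℂ] H => S T.Ω) hPt), key T.Ω hPΩ]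
    have h3 : s (t T.Ω) = t (s T.Ω) := congrArg (fun S : H →L[ℂ] H => S T.Ω) hst.eq
    rw [h3]
    exact t.le_opNorm _
  set d : H →L[ℂ] H := (orbitMap D.commutant.rep (t T.Ω)).extendOfNorm
    (orbitMap D.commutant.rep T.Ω) with hd
  have hdn : ∀ n : D.commutant, d (D.commutant.rep n T.Ω) = D.commutant.rep n (t T.Ω) :=
    fun n => LinearMap.extendOfNorm_eq hdense ⟨_, hbound⟩ n
  -- By construction d commutes with D', so the double commutant theorem applies.
  have hdD : d ∈ D := by
    rw [← VonNeumannAlgebra.commutant_commutant D, VonNeumannAlgebra.mem_commutant_iff]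
    intro g hg
    ext v
    refine congrFun (hdense.equalizer (g := fun v => (g * d) v) (h := fun v => (d * g) v)
      (by fun_prop) (by fun_prop) (funext fun n => ?_)) v
    change g (d (D.commutant.rep n T.Ω)) = d (D.commutant.rep ⟨g, hg⟩ (D.commutant.rep n T.Ω))
    rw [apply_apply, hdn, hdn, map_mul]
    rfl
  refine ⟨⟨d, hD hdD⟩, hdD, ?_⟩
  have htP : t = t * P := by rw [ht, mul_assoc, mul_assoc, mul_assoc, hPP]
  rw [htP]
  refine mul_jonesProjection_eq fun b hb => ?_
  change t (T.M.rep b T.Ω) = d (T.M.rep b T.Ω)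
  have hR : rightMul T.M.rep T.Ω b ∈ D.commutant := by
    rw [VonNeumannAlgebra.mem_commutant_iff]
    exact fun g hg => (T.isTraceVector.commute_rightMul b ⟨g, hD hg⟩).eq
  have hPR : Commute P (rightMul T.M.rep T.Ω b) :=
    T.isTraceVector.commute_jonesProjection_rightMul (T.mul_mem_elementsOf D)
      (T.star_mem_elementsOf D) hb
  have htR : Commute t (rightMul T.M.rep T.Ω b) := (hPR.mul_left (hx b hb)).mul_left hPR
  rw [← T.isTraceVector.rightMul_vec]
  have h1 := hdn ⟨_, hR⟩
  change d (rightMul T.M.rep T.Ω b T.Ω) = rightMul T.M.rep T.Ω b (t T.Ω) at h1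
  rw [h1]
  exact congrArg (fun S : H →L[ℂ] H => S T.Ω) htR.eq

/-- An operator commuting with all right multiplications is a left multiplication. -/
theorem mem_of_commute_rightMul {x : H →L[ℂ] H}
    (hx : ∀ d : T.M, Commute x (rightMul T.M.rep T.Ω d)) : x ∈ T.M := by
  obtain ⟨d, hd, h⟩ := exists_compression_eq (D := T.M) le_rfl (fun d _ => hx d)
  have hP : jonesProjection T.M.rep T.Ω (T.elementsOf T.M) = 1 := by
    ext v
    refine T.isTraceVector.eq_of_orbit (ContinuousLinearMap.continuous _)
      continuous_id (fun y => ?_) v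
    exact jonesProjection_orbit y.2
  rw [hP, one_mul, mul_one, mul_one] at h
  rw [h]
  exact hd

end TracialInclusion

theorem VonNeumannAlgebra.commute_of_mem_generatedBy {H : Type*} [NormedAddCommGroup H]
    [InnerProductSpace ℂ H] [CompleteSpace H] {S : Set (H →L[ℂ] H)} {x r : H →L[ℂ] H}
    (hx : x ∈ VonNeumannAlgebra.generatedBy S) (hr : ∀ s ∈ S, Commute s r)
    (hr' : ∀ s ∈ S, Commute (star s) r) : Commute x r := by
  have h1 : r ∈ StarSubalgebra.centralizer ℂ S :=
    (StarSubalgebra.mem_centralizer_iff ℂ).2 fun s hs => ⟨(hr s hs).eq, (hr' s hs).eq⟩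
  change x ∈ StarSubalgebra.centralizer ℂ (StarSubalgebra.centralizer ℂ S : Set (H →L[ℂ] H)) at hx
  exact (((StarSubalgebra.mem_centralizer_iff ℂ).1 hx r h1).1).symm

/-! ### The first Jones projection and its corner in M₁ -/

namespace TracialInclusion

variable {H : Type*} [NormedAddCommGroup H] [InnerProductSpace ℂ H] [CompleteSpace H]
variable (T : TracialInclusion H)

theorem star_e₁ : star T.e₁ = T.e₁ :=
  Subtype.ext (jonesProjection_isSelfAdjoint (π := T.M.rep) (ξ := T.Ω) (B := T.NinM)).star_eq

theorem e₁_mul_e₁ : T.e₁ * T.e₁ = T.e₁ :=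
  Subtype.ext (jonesProjection_mul_self (π := T.M.rep) (ξ := T.Ω) (B := T.NinM))

theorem commute_e₁ {n : T.M} (hn : n ∈ T.NinM) : T.e₁ * T.ι₀ n = T.ι₀ n * T.e₁ :=
  Subtype.ext (commute_jonesProjection_apply (π := T.M.rep) (ξ := T.Ω)
    (T.mul_mem_elementsOf T.N) (T.star_mem_elementsOf T.N) hn).eq

theorem e₁op_vec : T.e₁op T.Ω = T.Ω := jonesProjection_vec (T := T) (D := T.N)

theorem commute_rightMul_of_mem_M₁ (x : T.M₁) {n : T.M} (hn : n ∈ T.NinM) :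
    Commute (x : H →L[ℂ] H) (rightMul T.M.rep T.Ω n) := by
  have h : ∀ s ∈ (T.M : Set (H →L[ℂ] H)) ∪ {T.e₁op}, Commute s (rightMul T.M.rep T.Ω n) := by
    rintro s (hs | rfl)
    · exact T.isTraceVector.commute_rightMul n ⟨s, hs⟩
    · exact T.isTraceVector.commute_jonesProjection_rightMul
        (T.mul_mem_elementsOf T.N) (T.star_mem_elementsOf T.N) hn
  refine VonNeumannAlgebra.commute_of_mem_generatedBy x.2 h ?_
  rintro s (hs | rfl)
  · exact h _ (Or.inl (star_mem (S := VonNeumannAlgebra H) (s := T.M) hs))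
  · have h1 : star T.e₁op = T.e₁op :=
      (jonesProjection_isSelfAdjoint (π := T.M.rep) (ξ := T.Ω) (B := T.NinM)).star_eq
    rw [h1]
    exact h _ (Or.inr rfl)

/-- `e₁ M₁ e₁ = N e₁`. -/
theorem exists_e₁_mul_mul_e₁ (x : T.M₁) : ∃ n ∈ T.NinM, T.e₁ * x * T.e₁ = T.ι₀ n * T.e₁ := by
  obtain ⟨n, hn, h⟩ := exists_compression_eq (T := T) (D := T.N) T.le
    (x := (x : H →L[ℂ] H)) (fun d hd => T.commute_rightMul_of_mem_M₁ x hd)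
  exact ⟨n, hn, Subtype.ext h⟩

end TracialInclusion

/-! ### The embedding of L²(M) into L²(M₁) and the identity M₁ e₁ = M e₁ -/

namespace LambdaExtension

variable {H : Type*} [NormedAddCommGroup H] [InnerProductSpace ℂ H] [CompleteSpace H]
variable {T : TracialInclusion H} (E : LambdaExtension T)

theorem π₁_vec (a : T.M₁) : E.π₁ a E.Ω₁ = ((E.τ₁.toPreGNS a : E.τ₁.PreGNS) : E.τ₁.GNS) := by
  change E.τ₁.gnsNonUnitalStarAlgHom a ((E.τ₁.toPreGNS 1 : E.τ₁.PreGNS) : E.τ₁.GNS) = _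
  rw [PositiveLinearMap.gnsNonUnitalStarAlgHom_apply_coe]
  simp

theorem inner_π₁ (a b : T.M₁) : ⟪E.π₁ a E.Ω₁, E.π₁ b E.Ω₁⟫_ℂ = E.τ₁ (star a * b) := by
  rw [π₁_vec, π₁_vec, UniformSpace.Completion.inner_coe, PositiveLinearMap.preGNS_inner_def]
  simp

theorem inner_vec_π₁ (b : T.M₁) : ⟪E.Ω₁, E.π₁ b E.Ω₁⟫_ℂ = E.τ₁ b := by
  simpa using E.inner_π₁ 1 b

theorem isTraceVector : IsTraceVector E.π₁ E.Ω₁ where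
  dense := by
    have h : (orbitMap E.π₁ E.Ω₁ : T.M₁ → E.L2)
        = (fun a : E.τ₁.PreGNS => (a : E.τ₁.GNS)) ∘ E.τ₁.toPreGNS := funext E.π₁_vec
    rw [h]
    exact UniformSpace.Completion.denseRange_coe.comp E.τ₁.toPreGNS.surjective.denseRange
      (UniformSpace.Completion.continuous_coe _)
  trace x y := by rw [E.inner_vec_π₁, E.inner_vec_π₁, E.isTrace.trace]

/-- `τ₁(e₁ z) = lam τ(z)`. -/
theorem τ₁_e₁_mul (z : T.M) : E.τ₁ (T.e₁ * T.ι₀ z) = E.lam * T.τ z := by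
  have h := E.expectation z
  rw [← h, AlgHomClass.commutes, Algebra.algebraMap_eq_smul_one, smul_mul_assoc, one_mul,
    map_smul, E.extends_τ, smul_eq_mul]

theorem inner_τ (x y : T.M) : ⟪T.M.rep x T.Ω, T.M.rep y T.Ω⟫_ℂ = T.τ (star x * y) := by
  rw [inner_apply_star, apply_apply]; rfl

/-- The inclusion of `L²(M)` into `L²(M₁)`. -/
def incl : H →L[ℂ] E.L2 :=
  (orbitMap (E.π₁.comp T.ι₀) E.Ω₁).extendOfNorm (orbitMap T.M.rep T.Ω)

theorem incl_orbit (x : T.M) : E.incl (T.M.rep x T.Ω) = E.π₁ (T.ι₀ x) E.Ω₁ := by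
  refine LinearMap.extendOfNorm_eq T.isTraceVector.dense ⟨1, fun y => ?_⟩ x
  rw [one_mul]
  have h1 : ⟪E.π₁ (T.ι₀ y) E.Ω₁, E.π₁ (T.ι₀ y) E.Ω₁⟫_ℂ
      = ⟪T.M.rep y T.Ω, T.M.rep y T.Ω⟫_ℂ := by
    rw [E.inner_π₁, inner_τ, ← map_star, ← map_mul, E.extends_τ]
  rw [inner_self_eq_norm_sq_to_K, inner_self_eq_norm_sq_to_K] at h1
  have h2 : ‖E.π₁ (T.ι₀ y) E.Ω₁‖ ^ 2 = ‖T.M.rep y T.Ω‖ ^ 2 := by exact_mod_cast h1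
  exact ((sq_eq_sq₀ (norm_nonneg _) (norm_nonneg _)).1 h2).le

theorem incl_vec : E.incl T.Ω = E.Ω₁ := by
  simpa using E.incl_orbit 1

theorem inner_incl (u v : H) : ⟪E.incl u, E.incl v⟫_ℂ = ⟪u, v⟫_ℂ := by
  refine T.isTraceVector.eq_of_orbit (f := fun u => ⟪E.incl u, E.incl v⟫_ℂ)
    (g := fun u => ⟪u, v⟫_ℂ) (by fun_prop) (by fun_prop) (fun x => ?_) u
  refine T.isTraceVector.eq_of_orbit (f := fun v => ⟪E.incl (T.M.rep x T.Ω), E.incl v⟫_ℂ)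
    (g := fun v => ⟪T.M.rep x T.Ω, v⟫_ℂ) (by fun_prop) (by fun_prop) (fun y => ?_) v
  rw [incl_orbit, incl_orbit, inner_π₁, inner_τ, ← map_star, ← map_mul, E.extends_τ]

theorem norm_incl (u : H) : ‖E.incl u‖ = ‖u‖ := by
  have h1 := E.inner_incl u u
  rw [inner_self_eq_norm_sq_to_K, inner_self_eq_norm_sq_to_K] at h1
  have h2 : ‖E.incl u‖ ^ 2 = ‖u‖ ^ 2 := by exact_mod_cast h1
  exact (sq_eq_sq₀ (norm_nonneg _) (norm_nonneg _)).1 h2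

theorem incl_apply (x : T.M) (u : H) : E.incl (T.M.rep x u) = E.π₁ (T.ι₀ x) (E.incl u) := by
  refine T.isTraceVector.eq_of_orbit (f := fun u => E.incl (T.M.rep x u))
    (g := fun u => E.π₁ (T.ι₀ x) (E.incl u)) (by fun_prop) (by fun_prop) (fun y => ?_) u
  rw [apply_apply, incl_orbit, incl_orbit, apply_apply, map_mul]

theorem incl_rightMul (z : T.M) (u : H) :
    E.incl (rightMul T.M.rep T.Ω z u) = rightMul E.π₁ E.Ω₁ (T.ι₀ z) (E.incl u) := by
  refine T.isTraceVector.eq_of_orbit (f := fun u => E.incl (rightMul T.M.rep T.Ω z u))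
    (g := fun u => rightMul E.π₁ E.Ω₁ (T.ι₀ z) (E.incl u))
    (by fun_prop) (by fun_prop) (fun y => ?_) u
  rw [T.isTraceVector.rightMul_orbit, incl_orbit, incl_orbit, E.isTraceVector.rightMul_orbit,
    map_mul]

/-- The compression of an operator on `L²(M₁)` to `L²(M)`. -/
def compress (S : E.L2 →L[ℂ] E.L2) : H →L[ℂ] H :=
  (ContinuousLinearMap.adjoint E.incl ∘L S) ∘L E.incl

theorem inner_compress (S : E.L2 →L[ℂ] E.L2) (u v : H) :
    ⟪u, E.compress S v⟫_ℂ = ⟪E.incl u, S (E.incl v)⟫_ℂ := by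
  change ⟪u, ContinuousLinearMap.adjoint E.incl (S (E.incl v))⟫_ℂ = _
  rw [ContinuousLinearMap.adjoint_inner_right]

/-- The compression to `L²(M)` of an operator commuting with right multiplications by `M` is
in `M`. -/
theorem compress_mem {S : E.L2 →L[ℂ] E.L2}
    (hS : ∀ z : T.M, Commute S (rightMul E.π₁ E.Ω₁ (T.ι₀ z))) : E.compress S ∈ T.M := by
  refine TracialInclusion.mem_of_commute_rightMul fun z => ?_
  ext v
  refine ext_inner_left ℂ fun u => ?_
  change ⟪u, E.compress S (rightMul T.M.rep T.Ω z v)⟫_ℂ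
    = ⟪u, rightMul T.M.rep T.Ω z (E.compress S v)⟫_ℂ
  have h1 : S (rightMul E.π₁ E.Ω₁ (T.ι₀ z) (E.incl v))
      = rightMul E.π₁ E.Ω₁ (T.ι₀ z) (S (E.incl v)) :=
    congrArg (fun S : E.L2 →L[ℂ] E.L2 => S (E.incl v)) (hS z).eq
  have h2 : ContinuousLinearMap.adjoint (rightMul T.M.rep T.Ω z)
      = rightMul T.M.rep T.Ω (star z) := T.isTraceVector.star_rightMul z
  have h3 : ContinuousLinearMap.adjoint (rightMul E.π₁ E.Ω₁ (T.ι₀ z))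
      = rightMul E.π₁ E.Ω₁ (T.ι₀ (star z)) := by
    rw [map_star]; exact E.isTraceVector.star_rightMul (T.ι₀ z)
  rw [inner_compress, incl_rightMul, h1, ← ContinuousLinearMap.adjoint_inner_left,
    ← ContinuousLinearMap.adjoint_inner_left (rightMul T.M.rep T.Ω z), inner_compress, h2, h3,
    incl_rightMul]

/-- Every element of `M₁ e₁` is of the form `x e₁` with `x ∈ M`. -/
theorem exists_mul_e₁ (E : LambdaExtension T) (m : T.M₁) : ∃ x : T.M, m * T.e₁ = T.ι₀ x * T.e₁ := by
  have hmem : E.compress (E.π₁ (m * T.e₁)) ∈ T.M :=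
    E.compress_mem fun z => E.isTraceVector.commute_rightMul _ _
  set c : T.M := ⟨_, hmem⟩ with hc
  have hcz : ∀ z, T.τ (c * z) = E.τ₁ (m * T.e₁ * T.ι₀ z) := by
    intro z
    have h1 := E.inner_compress (E.π₁ (m * T.e₁)) T.Ω (T.M.rep z T.Ω)
    rw [incl_vec, incl_orbit, apply_apply, inner_vec_π₁] at h1
    rw [← h1]
    rfl
  have hlam : (E.lam : ℂ) ≠ 0 := by exact_mod_cast E.lam_pos.ne'
  -- By `hcz`, c is the conditional expectation of m e₁ onto M; since that of x e₁ is lam x, the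
  -- only candidate is x = lam⁻¹ c.
  refine ⟨(E.lam : ℂ)⁻¹ • c, ?_⟩
  set x : T.M := (E.lam : ℂ)⁻¹ • c with hx
  set w : T.M₁ := m * T.e₁ - T.ι₀ x * T.e₁ with hw
  have hwe : w * T.e₁ = w := by
    rw [hw, sub_mul, mul_assoc, mul_assoc, T.e₁_mul_e₁]
  have hw0 : ∀ z, E.τ₁ (w * T.ι₀ z) = 0 := by
    intro z
    have h1 : E.τ₁ (T.ι₀ x * T.e₁ * T.ι₀ z) = E.lam * T.τ (x * z) := by
      rw [mul_assoc, E.isTrace.trace, mul_assoc, ← map_mul, τ₁_e₁_mul]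
      congr 1
      exact T.trace _ z.2 _ x.2
    have h2 : T.τ (x * z) = (E.lam : ℂ)⁻¹ * T.τ (c * z) := by
      rw [hx, smul_mul_assoc]
      change ⟪T.Ω, (E.lam : ℂ)⁻¹ • ((c * z : T.M) : H →L[ℂ] H) T.Ω⟫_ℂ = _
      rw [inner_smul_right]; rfl
    rw [hw, sub_mul, map_sub, ← hcz, h1, h2, mul_inv_cancel_left₀ hlam, sub_self]
  -- As w = w e₁, the element e₁ y w is n e₁ for some n ∈ N. Then lam τ(n⋆n) = τ₁(n⋆ e₁ y w) = τ₁(w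
  -- n⋆ y) = 0 by traciality, whence n = 0.
  have hew : ∀ y : T.M, T.e₁ * (T.ι₀ y * w) = 0 := by
    intro y
    obtain ⟨n, hn, h⟩ := T.exists_e₁_mul_mul_e₁ (T.ι₀ y * w)
    have h1 : T.e₁ * (T.ι₀ y * w) = T.ι₀ n * T.e₁ := by
      rw [← h, mul_assoc, mul_assoc, hwe]
    have hn' : star n ∈ T.NinM := T.star_mem_elementsOf T.N n hn
    have h2 : E.τ₁ (T.ι₀ (star n) * (T.ι₀ n * T.e₁)) = 0 := by
      rw [← h1, E.isTrace.trace, mul_assoc, E.isTrace.trace]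
      have h3 : T.ι₀ y * w * T.ι₀ (star n) * T.e₁ = T.ι₀ y * (w * T.ι₀ (star n)) := by
        rw [mul_assoc, ← T.commute_e₁ hn', ← mul_assoc, mul_assoc (T.ι₀ y) w, hwe, mul_assoc]
      rw [h3, E.isTrace.trace, mul_assoc, ← map_mul, hw0]
    have h4 : n = 0 := by
      rw [← mul_assoc, E.isTrace.trace, ← map_mul, τ₁_e₁_mul] at h2
      have h5 := (mul_eq_zero.1 h2).resolve_left hlam
      rw [← inner_τ, inner_self_eq_zero] at h5
      have h6 : T.M.rep n = 0 :=
        T.isTraceVector.eq_zero_of_commute (fun z => T.isTraceVector.commute_rightMul _ _) h5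
      exact Subtype.ext h6
    rw [h1, h4, map_zero, zero_mul]
  -- Pairing e₁ y⋆ w v = 0 with Ω = e₁Ω shows that w v is orthogonal to every yΩ.
  have hzero : (w : H →L[ℂ] H) = 0 := by
    ext v
    refine T.isTraceVector.eq_of_orbit (f := fun u => ⟪u, (w : H →L[ℂ] H) v⟫_ℂ)
      (g := fun _ => (0 : ℂ)) (by fun_prop) (by fun_prop) (fun y => ?_)
      ((w : H →L[ℂ] H) v) |> inner_self_eq_zero.1
    have h1 := congrArg (fun S : T.M₁ => (S : H →L[ℂ] H) v) (hew (star y))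
    change T.e₁op (T.M.rep (star y) ((w : H →L[ℂ] H) v)) = 0 at h1
    have h2 := congrArg (fun u => ⟪T.Ω, u⟫_ℂ) h1
    simp only [inner_zero_right] at h2
    have hsa : ContinuousLinearMap.adjoint T.e₁op = T.e₁op :=
      (jonesProjection_isSelfAdjoint (π := T.M.rep) (ξ := T.Ω) (B := T.NinM)).star_eq
    rwa [← ContinuousLinearMap.adjoint_inner_left, hsa, T.e₁op_vec, ← inner_apply_star] at h2
  exact sub_eq_zero.1 (Subtype.ext hzero)

end LambdaExtension

/-! ### The ideal spanned by M e₁ M, its approximate unit, and totality of M e₁ M Ω₁ -/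

namespace TracialInclusion

variable {H : Type*} [NormedAddCommGroup H] [InnerProductSpace ℂ H] [CompleteSpace H]
variable (T : TracialInclusion H)

/-- The linear span of `M e₁ M`. -/
def basicIdeal : Submodule ℂ T.M₁ :=
  Submodule.span ℂ (Set.range fun p : T.M × T.M => T.ι₀ p.1 * T.e₁ * T.ι₀ p.2)

theorem mem_basicIdeal (x y : T.M) : T.ι₀ x * T.e₁ * T.ι₀ y ∈ T.basicIdeal :=
  Submodule.subset_span ⟨(x, y), rfl⟩

theorem star_mem_basicIdeal {a : T.M₁} (ha : a ∈ T.basicIdeal) : star a ∈ T.basicIdeal := by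
  induction ha using Submodule.span_induction with
  | mem a ha =>
    obtain ⟨p, rfl⟩ := ha
    have h : star (T.ι₀ p.1 * T.e₁ * T.ι₀ p.2) = T.ι₀ (star p.2) * T.e₁ * T.ι₀ (star p.1) := by
      rw [star_mul, star_mul, T.star_e₁, map_star, map_star, mul_assoc]
    change star (T.ι₀ p.1 * T.e₁ * T.ι₀ p.2) ∈ _
    rw [h]
    exact T.mem_basicIdeal _ _
  | zero => simp
  | add a b _ _ ha hb => rw [star_add]; exact add_mem ha hb
  | smul c a _ ha => rw [star_smul]; exact Submodule.smul_mem _ _ ha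

variable {T}

theorem mul_mem_basicIdeal (E : LambdaExtension T) (m : T.M₁) {a : T.M₁} (ha : a ∈ T.basicIdeal) :
    m * a ∈ T.basicIdeal := by
  induction ha using Submodule.span_induction with
  | mem a ha =>
    obtain ⟨p, rfl⟩ := ha
    obtain ⟨x, hx⟩ := E.exists_mul_e₁ (m * T.ι₀ p.1)
    have h : m * (T.ι₀ p.1 * T.e₁ * T.ι₀ p.2) = T.ι₀ x * T.e₁ * T.ι₀ p.2 := by
      rw [← hx]; simp only [mul_assoc]
    change m * (T.ι₀ p.1 * T.e₁ * T.ι₀ p.2) ∈ _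
    rw [h]
    exact T.mem_basicIdeal _ _
  | zero => simp
  | add a b _ _ ha hb => rw [mul_add]; exact add_mem ha hb
  | smul c a _ ha => rw [mul_smul_comm]; exact Submodule.smul_mem _ _ ha

theorem mul_mem_basicIdeal_right (E : LambdaExtension T) (m : T.M₁) {a : T.M₁}
    (ha : a ∈ T.basicIdeal) : a * m ∈ T.basicIdeal := by
  have h := T.star_mem_basicIdeal (mul_mem_basicIdeal E (star m) (T.star_mem_basicIdeal ha))
  rwa [star_mul, star_star, star_star] at h

end TracialInclusion

section OneAdd

variable {A : Type*} [CStarAlgebra A] [PartialOrder A] [StarOrderedRing A]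

theorem isStrictlyPositive_one_add {h : A} (hh : 0 ≤ h) : IsStrictlyPositive (1 + h) :=
  IsStrictlyPositive.add_nonneg (isStrictlyPositive_one) hh

theorem one_add_mul_inverse {h : A} (hh : 0 ≤ h) : (1 + h) * Ring.inverse (1 + h) = 1 :=
  Ring.mul_inverse_cancel _ (isStrictlyPositive_one_add hh).isUnit

theorem inverse_mul_one_add {h : A} (hh : 0 ≤ h) : Ring.inverse (1 + h) * (1 + h) = 1 :=
  Ring.inverse_mul_cancel _ (isStrictlyPositive_one_add hh).isUnit

theorem inverse_one_add_nonneg {h : A} (hh : 0 ≤ h) : 0 ≤ Ring.inverse (1 + h) :=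
  (isStrictlyPositive_one_add hh).ringInverse.nonneg

/-- With r = (1 + h)⁻¹, the difference r - r² is r h r. -/
theorem inverse_one_add_sq_le {h : A} (hh : 0 ≤ h) :
    Ring.inverse (1 + h) * Ring.inverse (1 + h) ≤ Ring.inverse (1 + h) := by
  set r := Ring.inverse (1 + h) with hr
  have hsa : star r = r := (IsSelfAdjoint.of_nonneg (inverse_one_add_nonneg hh)).star_eq
  have h1 : r = r * r + star r * h * r := by
    rw [hsa]
    calc r = r * (1 + h) * r := by rw [hr, inverse_mul_one_add hh, one_mul]
      _ = _ := by noncomm_ring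
  conv_rhs => rw [h1]
  exact le_add_of_nonneg_right (star_left_conjugate_nonneg hh r)

theorem inverse_one_add_anti {h k : A} (hh : 0 ≤ h) (hk : h ≤ k) :
    Ring.inverse (1 + k) ≤ Ring.inverse (1 + h) :=
  CStarAlgebra.ringInverse_le_ringInverse (add_le_add_right hk 1) (isStrictlyPositive_one_add hh)

end OneAdd

namespace TracialInclusion

variable {H : Type*} [NormedAddCommGroup H] [InnerProductSpace ℂ H] [CompleteSpace H]
variable {T : TracialInclusion H}

/-- The vector η = r g ζ solves η + t g g⋆η = gζ. Pairing with η gives ‖η‖² + t‖g⋆η‖² = ⟨ζ, g⋆η⟩ ≤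
‖ζ‖ ‖g⋆η‖, hence t‖g⋆η‖ ≤ ‖ζ‖. -/
theorem inner_inverse_le {H : Type*} [NormedAddCommGroup H] [InnerProductSpace ℂ H]
    [CompleteSpace H] {g r : H →L[ℂ] H} {t : ℝ} (ht : 0 < t)
    (hr : (1 + (t : ℂ) • (g * star g)) * r = 1) (ζ : H) :
    (⟪g ζ, r (g ζ)⟫_ℂ).re ≤ ‖ζ‖ ^ 2 / t := by
  set η := r (g ζ) with hη
  set s := ‖star g η‖ with hs
  have h1 : η + (t : ℂ) • g (star g η) = g ζ :=
    congrArg (fun S : H →L[ℂ] H => S (g ζ)) hr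
  have h2 : ⟪g ζ, η⟫_ℂ = ⟪ζ, star g η⟫_ℂ := by
    rw [ContinuousLinearMap.star_eq_adjoint, ContinuousLinearMap.adjoint_inner_right]
  have h3 : ⟪g ζ, η⟫_ℂ = ((‖η‖ ^ 2 + t * s ^ 2 : ℝ) : ℂ) := by
    rw [← h1, inner_add_left, inner_smul_left, ← ContinuousLinearMap.adjoint_inner_right g,
      ← ContinuousLinearMap.star_eq_adjoint, inner_self_eq_norm_sq_to_K,
      inner_self_eq_norm_sq_to_K]
    simp [hs]
  have h4 : (⟪g ζ, η⟫_ℂ).re ≤ ‖ζ‖ * s := by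
    rw [h2]
    exact (Complex.re_le_norm _).trans (norm_inner_le_norm _ _)
  have h5 : ‖η‖ ^ 2 + t * s ^ 2 ≤ ‖ζ‖ * s := by
    rw [h3, Complex.ofReal_re] at h4; exact h4
  have hs0 : 0 ≤ s := norm_nonneg _
  have h6 : t * s ≤ ‖ζ‖ := by
    rcases hs0.eq_or_lt with h | h
    · rw [← h, mul_zero]; exact norm_nonneg _
    · refine le_of_mul_le_mul_right ?_ h
      nlinarith [sq_nonneg ‖η‖]
  refine h4.trans ?_
  rw [le_div_iff₀ ht]
  nlinarith [norm_nonneg ζ]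

/-- The elements `1 - (1 + h)⁻¹` with `h` a positive element of the span of `M e₁ M`. -/
def approxUnit (T : TracialInclusion H) : Set T.M₁ :=
  (fun h => 1 - Ring.inverse (1 + h)) '' {h | h ∈ T.basicIdeal ∧ 0 ≤ h}

theorem approxUnit_nonempty : T.approxUnit.Nonempty :=
  ⟨_, 0, ⟨zero_mem _, le_rfl⟩, rfl⟩

theorem directedOn_approxUnit : DirectedOn (· ≤ ·) T.approxUnit := by
  rintro _ ⟨h, ⟨hI, hh⟩, rfl⟩ _ ⟨k, ⟨kI, hk⟩, rfl⟩
  refine ⟨_, ⟨h + k, ⟨add_mem hI kI, add_nonneg hh hk⟩, rfl⟩, ?_, ?_⟩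
  · exact sub_le_sub_left (inverse_one_add_anti hh (le_add_of_nonneg_right hk)) 1
  · exact sub_le_sub_left (inverse_one_add_anti hk (le_add_of_nonneg_left hh)) 1

/-- An upper bound c only has to be compared with 1 on the dense set of vectors xΩ, and xΩ = (x e₁)Ω
is in the range of an element of the ideal. Scaling that element makes the resolvent as small as
desired at xΩ. -/
theorem isLUB_approxUnit (E : LambdaExtension T) : IsLUB T.approxUnit 1 := by
  constructor
  · rintro _ ⟨h, ⟨hI, hh⟩, rfl⟩
    exact sub_le_self _ (inverse_one_add_nonneg hh)
  · intro c hc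
    have hc0 : 0 ≤ c := by
      have := hc ⟨0, ⟨zero_mem _, le_rfl⟩, rfl⟩
      simpa using this
    have hsa : IsSelfAdjoint ((c - 1 : T.M₁) : H →L[ℂ] H) := by
      have h1 : IsSelfAdjoint (c - 1) := (IsSelfAdjoint.of_nonneg hc0).sub (.one _)
      exact congrArg Subtype.val h1.star_eq
    rw [← sub_nonneg]
    change (0 : H →L[ℂ] H) ≤ ((c - 1 : T.M₁) : H →L[ℂ] H)
    rw [ContinuousLinearMap.nonneg_iff_isPositive, ContinuousLinearMap.isPositive_iff_complex]
    have hre : ∀ ζ : H, 0 ≤ (⟪ζ, ((c - 1 : T.M₁) : H →L[ℂ] H) ζ⟫_ℂ).re := by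
      intro ζ
      have hclosed : IsClosed {ζ : H | 0 ≤ (⟪ζ, ((c - 1 : T.M₁) : H →L[ℂ] H) ζ⟫_ℂ).re} :=
        isClosed_le continuous_const (Complex.continuous_re.comp (by fun_prop))
      refine isClosed_property T.isTraceVector.dense hclosed (fun x => ?_) ζ
      refine le_of_forall_pos_le_add fun ε hε => ?_
      set g : T.M₁ := T.ι₀ x * T.e₁ with hg
      have hgI : g ∈ T.basicIdeal := by
        have := T.mem_basicIdeal x 1
        rwa [map_one, mul_one] at this
      -- The factor ε⁻¹ makes `inner_inverse_le` bound ⟨xΩ, (1 + h)⁻¹ xΩ⟩ by exactly ε, since gΩ =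
      -- xΩ and ‖Ω‖ = 1.
      set h : T.M₁ := ((ε⁻¹ : ℝ) : ℂ) • (g * star g) with hh
      have hI : h ∈ T.basicIdeal := Submodule.smul_mem _ _ (mul_mem_basicIdeal_right E _ hgI)
      have h0 : 0 ≤ h := by
        refine smul_nonneg ?_ (mul_star_self_nonneg g)
        exact_mod_cast (inv_pos.2 hε).le
      have h1 : 1 - Ring.inverse (1 + h) ≤ c := hc ⟨h, ⟨hI, h0⟩, rfl⟩
      set r := Ring.inverse (1 + h) with hr
      have h2 : (0 : H →L[ℂ] H) ≤ ((c - 1 + r : T.M₁) : H →L[ℂ] H) := by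
        have : 0 ≤ c - 1 + r := by
          have := sub_nonneg.2 h1
          rwa [← sub_add] at this
        exact this
      rw [ContinuousLinearMap.nonneg_iff_isPositive] at h2
      have hgx : (g : H →L[ℂ] H) T.Ω = T.M.rep x T.Ω := by
        change T.M.rep x (T.e₁op T.Ω) = _
        rw [T.e₁op_vec]
      have h3 := h2.re_inner_nonneg_right (T.M.rep x T.Ω)
      have hr1 : (1 + (((ε⁻¹ : ℝ) : ℂ) • ((g : H →L[ℂ] H) * star (g : H →L[ℂ] H))))
          * (r : H →L[ℂ] H) = 1 :=
        congrArg Subtype.val (one_add_mul_inverse h0)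
      have h4 := inner_inverse_le (inv_pos.2 hε) hr1 T.Ω
      rw [hgx, T.norm_Ω, one_pow, one_div, inv_inv] at h4
      have h5 : ((c - 1 + r : T.M₁) : H →L[ℂ] H) (T.M.rep x T.Ω)
          = ((c - 1 : T.M₁) : H →L[ℂ] H) (T.M.rep x T.Ω) + (r : H →L[ℂ] H) (T.M.rep x T.Ω) := rfl
      rw [h5, inner_add_right, map_add] at h3
      change 0 ≤ (⟪T.M.rep x T.Ω, ((c - 1 : T.M₁) : H →L[ℂ] H) (T.M.rep x T.Ω)⟫_ℂ).re + ε
      have h6 : 0 ≤ (⟪T.M.rep x T.Ω, ((c - 1 : T.M₁) : H →L[ℂ] H) (T.M.rep x T.Ω)⟫_ℂ).re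
        + (⟪T.M.rep x T.Ω, (r : H →L[ℂ] H) (T.M.rep x T.Ω)⟫_ℂ).re := h3
      linarith
    intro ζ
    have h1 := hre ζ
    have hsym : ⟪((c - 1 : T.M₁) : H →L[ℂ] H) ζ, ζ⟫_ℂ = ⟪ζ, ((c - 1 : T.M₁) : H →L[ℂ] H) ζ⟫_ℂ :=
      (ContinuousLinearMap.isSelfAdjoint_iff_isSymmetric.1 hsa) ζ ζ
    refine ⟨?_, by rw [hsym]; exact h1⟩
    have h2 := inner_conj_symm (𝕜 := ℂ) ζ (((c - 1 : T.M₁) : H →L[ℂ] H) ζ)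
    rw [hsym] at h2
    rw [hsym]
    exact Complex.conj_eq_iff_re.1 h2

end TracialInclusion

namespace LambdaExtension

variable {H : Type*} [NormedAddCommGroup H] [InnerProductSpace ℂ H] [CompleteSpace H]
variable {T : TracialInclusion H} (E : LambdaExtension T)

/-- The vectors `aΩ₁` with `a` in the span of `M e₁ M`. -/
def cornerSpace : Submodule ℂ E.L2 := T.basicIdeal.map (orbitMap E.π₁ E.Ω₁)

/-- Normality turns the supremum 1 of the approximate unit into sup τ₁(1 - r) = 1, and ‖Ω₁ - (1 -
r)Ω₁‖² = τ₁(r²) ≤ τ₁(r). -/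
theorem vec_mem_closure_cornerSpace : E.Ω₁ ∈ E.cornerSpace.topologicalClosure := by
  refine Metric.mem_closure_iff.2 fun ε hε => ?_
  have hlub := E.isTrace.normal T.approxUnit_nonempty T.directedOn_approxUnit
    (T.isLUB_approxUnit E)
  rw [E.isTrace.map_one] at hlub
  have h1 : ¬ (((1 - ε ^ 2 : ℝ) : ℂ) ∈ upperBounds (E.τ₁ '' T.approxUnit)) := by
    intro h
    have h2 := (Complex.le_def.1 (hlub.2 h)).1
    simp only [Complex.one_re, Complex.ofReal_re] at h2
    nlinarith [sq_pos_of_pos hε]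
  simp only [mem_upperBounds, not_forall] at h1
  obtain ⟨_, ⟨_, ⟨h, ⟨hI, hh⟩, rfl⟩, rfl⟩, h2⟩ := h1
  set r := Ring.inverse (1 + h) with hr
  have hr0 : 0 ≤ r := inverse_one_add_nonneg hh
  have hrs : star r = r := (IsSelfAdjoint.of_nonneg hr0).star_eq
  have hτr : 0 ≤ E.τ₁ r := map_nonneg E.τ₁ hr0
  have him := (Complex.le_def.1 hτr).2
  have hτ1 : E.τ₁ (1 - r) = 1 - E.τ₁ r := by rw [map_sub, E.isTrace.map_one]
  have h3 : (E.τ₁ r).re < ε ^ 2 := by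
    by_contra hcon
    apply h2
    rw [hτ1, Complex.le_def]
    simp only [Complex.sub_re, Complex.one_re, Complex.ofReal_re, Complex.sub_im, Complex.one_im,
      Complex.ofReal_im, Complex.zero_im] at him ⊢
    exact ⟨by linarith, by rw [← him, sub_zero]⟩
  refine ⟨E.π₁ (1 - r) E.Ω₁, ⟨1 - r, ?_, rfl⟩, ?_⟩
  -- This puts 1 - r in the ideal although r is not given as an element of it.
  · have h4 : 1 - r = h * r := by
      have := one_add_mul_inverse hh
      rw [add_mul, one_mul, ← hr] at this
      rw [← this]; abel
    rw [h4]
    exact TracialInclusion.mul_mem_basicIdeal_right E _ hI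
  · have h5 : E.Ω₁ - E.π₁ (1 - r) E.Ω₁ = E.π₁ r E.Ω₁ := by
      rw [map_sub, map_one]; simp
    rw [dist_eq_norm, h5]
    have h6 : ((‖E.π₁ r E.Ω₁‖ ^ 2 : ℝ) : ℂ) = E.τ₁ (r * r) := by
      have := E.inner_π₁ r r
      rw [inner_self_eq_norm_sq_to_K, hrs] at this
      rw [← this]; simp
    have h7 : E.τ₁ (r * r) ≤ E.τ₁ r := OrderHomClass.mono E.τ₁ (inverse_one_add_sq_le hh)
    rw [← h6] at h7
    have h8 := (Complex.le_def.1 h7).1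
    rw [Complex.ofReal_re] at h8
    exact lt_of_pow_lt_pow_left₀ 2 hε.le (h8.trans_lt h3)

/-- `M e₁ M Ω₁` spans a dense subspace of `L²(M₁)`. -/
theorem dense_cornerSpace : Dense (E.cornerSpace : Set E.L2) := by
  intro v
  have h2 : ∀ m : T.M₁, ∀ u ∈ E.cornerSpace, E.π₁ m u ∈ E.cornerSpace := by
    intro m u hu
    obtain ⟨a, ha, rfl⟩ := Submodule.mem_map.1 hu
    refine Submodule.mem_map.2 ⟨m * a, TracialInclusion.mul_mem_basicIdeal E m ha, ?_⟩
    rw [orbitMap_apply, orbitMap_apply, apply_apply]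
  have h1 : ∀ m : T.M₁, E.π₁ m E.Ω₁ ∈ E.cornerSpace.topologicalClosure := fun m =>
    map_mem_closure (E.π₁ m).continuous E.vec_mem_closure_cornerSpace (h2 m)
  have h3 : IsClosed (E.cornerSpace.topologicalClosure : Set E.L2) :=
    Submodule.isClosed_topologicalClosure _
  exact isClosed_property E.isTraceVector.dense h3 h1 v

end LambdaExtension

/-! ### Compression to L²(M), convolution and Fourier multipliers -/

namespace TracialInclusion

variable {H : Type*} [NormedAddCommGroup H] [InnerProductSpace ℂ H] [CompleteSpace H]
variable {T : TracialInclusion H}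

theorem ext_of_orbit {a b : T.M} (h : T.M.rep a T.Ω = T.M.rep b T.Ω) : a = b :=
  Subtype.ext (T.isTraceVector.eq_of_commute (S := T.M.rep a) (R := T.M.rep b)
    (fun _ => T.isTraceVector.commute_rightMul _ _)
    (fun _ => T.isTraceVector.commute_rightMul _ _) h)

theorem ext_of_τ {a b : T.M} (h : ∀ u, T.τ (star u * a) = T.τ (star u * b)) : a = b := by
  refine ext_of_orbit (T.isTraceVector.eq_of_orbit (f := fun v => ⟪v, T.M.rep a T.Ω⟫_ℂ)
    (g := fun v => ⟪v, T.M.rep b T.Ω⟫_ℂ) (by fun_prop) (by fun_prop) (fun u => ?_) |>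
    ext_inner_left ℂ)
  rw [LambdaExtension.inner_τ, LambdaExtension.inner_τ, h]

theorem τ_comm (a b : T.M) : T.τ (a * b) = T.τ (b * a) := T.trace _ a.2 _ b.2

theorem τ_add (a b : T.M) : T.τ (a + b) = T.τ a + T.τ b := by
  change ⟪T.Ω, T.M.rep a T.Ω + T.M.rep b T.Ω⟫_ℂ = _
  rw [inner_add_right]; rfl

theorem τ_smul (c : ℂ) (a : T.M) : T.τ (c • a) = c * T.τ a := by
  change ⟪T.Ω, c • T.M.rep a T.Ω⟫_ℂ = _
  rw [inner_smul_right]; rfl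

theorem τ_zero : T.τ 0 = 0 := by
  simpa using T.τ_smul 0 0

theorem τ_neg (a : T.M) : T.τ (-a) = -T.τ a := by
  simpa using T.τ_smul (-1) a

theorem τ_sub (a b : T.M) : T.τ (a - b) = T.τ a - T.τ b := by
  rw [sub_eq_add_neg, τ_add, τ_neg, sub_eq_add_neg]

end TracialInclusion

namespace LambdaExtension

variable {H : Type*} [NormedAddCommGroup H] [InnerProductSpace ℂ H] [CompleteSpace H]
variable {T : TracialInclusion H} (E : LambdaExtension T)

theorem e₂op_isSelfAdjoint : IsSelfAdjoint E.e₂op := jonesProjection_isSelfAdjoint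

theorem e₂op_incl (v : H) : E.e₂op (E.incl v) = E.incl v := by
  refine T.isTraceVector.eq_of_orbit (f := fun v => E.e₂op (E.incl v))
    (by fun_prop) E.incl.continuous (fun x => ?_) v
  rw [incl_orbit]
  exact jonesProjection_orbit ⟨x, rfl⟩

theorem e₂op_apply (v : E.L2) : E.e₂op v = E.incl (ContinuousLinearMap.adjoint E.incl v) := by
  refine eq_of_inner_orbit (π := E.π₁) (ξ := E.Ω₁) (B := Set.range T.ι₀) ?_ (E.e₂op_incl _) ?_
  · exact congrArg (fun S : E.L2 →L[ℂ] E.L2 => S v)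
      (jonesProjection_mul_self (π := E.π₁) (ξ := E.Ω₁) (B := Set.range T.ι₀))
  · rintro _ ⟨x, rfl⟩
    have h1 : ContinuousLinearMap.adjoint E.e₂op = E.e₂op := E.e₂op_isSelfAdjoint.star_eq
    rw [← incl_orbit, inner_incl, ContinuousLinearMap.adjoint_inner_right,
      ← ContinuousLinearMap.adjoint_inner_left, h1, e₂op_incl]

theorem mul_mem_range : ∀ a ∈ Set.range T.ι₀, ∀ b ∈ Set.range T.ι₀, a * b ∈ Set.range T.ι₀ := by
  rintro _ ⟨x, rfl⟩ _ ⟨y, rfl⟩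
  exact ⟨x * y, map_mul _ _ _⟩

theorem star_mem_range : ∀ a ∈ Set.range T.ι₀, star a ∈ Set.range T.ι₀ := by
  rintro _ ⟨x, rfl⟩
  exact ⟨star x, map_star _ _⟩

theorem commute_rightMul_of_mem_M₂ (y : E.M₂) (z : T.M) :
    Commute (y : E.L2 →L[ℂ] E.L2) (rightMul E.π₁ E.Ω₁ (T.ι₀ z)) := by
  have h : ∀ s ∈ Set.range E.π₁ ∪ {E.e₂op}, Commute s (rightMul E.π₁ E.Ω₁ (T.ι₀ z)) := by
    rintro s (⟨a, rfl⟩ | rfl)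
    · exact E.isTraceVector.commute_rightMul _ _
    · exact E.isTraceVector.commute_jonesProjection_rightMul mul_mem_range star_mem_range ⟨z, rfl⟩
  refine VonNeumannAlgebra.commute_of_mem_generatedBy y.2 h ?_
  rintro s (⟨a, rfl⟩ | rfl)
  · exact h _ (Or.inl ⟨star a, map_star _ _⟩)
  · rw [E.e₂op_isSelfAdjoint.star_eq]
    exact h _ (Or.inr rfl)

theorem e₂_mem_relCommutant : E.e₂ ∈ E.relCommutant := fun x =>
  Subtype.ext (commute_jonesProjection_apply (π := E.π₁) (ξ := E.Ω₁) mul_mem_range star_mem_range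
    ⟨x, rfl⟩).symm.eq

/-- The vector `x e₁ y Ω₁`. -/
def cornerVec (x y : T.M) : E.L2 := E.π₁ (T.ι₀ x * T.e₁ * T.ι₀ y) E.Ω₁

/-- The adjoint of the embedding implements the conditional expectation onto M, and that of x e₁ y
is lam x y. -/
theorem adjoint_incl_cornerVec (x y : T.M) :
    ContinuousLinearMap.adjoint E.incl (E.cornerVec x y) = (E.lam : ℂ) • T.M.rep (x * y) T.Ω := by
  refine ext_inner_left ℂ (T.isTraceVector.eq_of_orbit
    (f := fun v => ⟪v, ContinuousLinearMap.adjoint E.incl (E.cornerVec x y)⟫_ℂ)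
    (g := fun v => ⟪v, (E.lam : ℂ) • T.M.rep (x * y) T.Ω⟫_ℂ) (by fun_prop) (by fun_prop)
    fun z => ?_)
  rw [ContinuousLinearMap.adjoint_inner_right, incl_orbit, cornerVec, inner_π₁, inner_smul_right,
    inner_τ, ← mul_assoc, E.isTrace.trace, ← map_star, ← mul_assoc, ← map_mul, ← mul_assoc,
    ← map_mul, E.isTrace.trace, τ₁_e₁_mul, mul_assoc, T.τ_comm, mul_assoc]

theorem e₂op_cornerVec (x y : T.M) :
    E.e₂op (E.cornerVec x y) = (E.lam : ℂ) • E.π₁ (T.ι₀ (x * y)) E.Ω₁ := by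
  rw [e₂op_apply, adjoint_incl_cornerVec, map_smul, incl_orbit]

theorem π₁_cornerVec (x y z : T.M) :
    E.π₁ (T.ι₀ z) (E.cornerVec x y) = E.cornerVec (z * x) y := by
  rw [cornerVec, cornerVec, apply_apply, map_mul T.ι₀]; simp only [mul_assoc]

theorem J₁_cornerVec (x y : T.M) : E.J₁ (E.cornerVec x y) = E.cornerVec (star y) (star x) := by
  rw [cornerVec, cornerVec, J₁, E.isTraceVector.modularConjugation_apply, star_mul, star_mul,
    T.star_e₁, map_star, map_star, mul_assoc]

/-- The element of `M` which is the compression to `L²(M)` of `e₁ y x e₁`. -/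
def compressed (y : E.M₂) (x : T.M) : T.M :=
  ⟨E.compress (E.π₁ T.e₁ * y * E.π₁ (T.ι₀ x) * E.π₁ T.e₁), E.compress_mem fun z =>
    (((E.isTraceVector.commute_rightMul _ _).mul_left (E.commute_rightMul_of_mem_M₂ y z)).mul_left
      (E.isTraceVector.commute_rightMul _ _)).mul_left (E.isTraceVector.commute_rightMul _ _)⟩

theorem π₁_e₁_incl (w : T.M) : E.π₁ T.e₁ (E.incl (T.M.rep w T.Ω)) = E.cornerVec 1 w := by
  rw [incl_orbit, apply_apply, cornerVec, map_one, one_mul]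

theorem star_π₁_e₁ : star (E.π₁ T.e₁) = E.π₁ T.e₁ := by
  rw [← map_star, T.star_e₁]

theorem inner_compressed (y : E.M₂) (x u w : T.M) :
    ⟪T.M.rep u T.Ω, T.M.rep (E.compressed y x) (T.M.rep w T.Ω)⟫_ℂ
      = ⟪E.cornerVec 1 u, (y : E.L2 →L[ℂ] E.L2) (E.cornerVec x w)⟫_ℂ := by
  have h1 := E.inner_compress (E.π₁ T.e₁ * y * E.π₁ (T.ι₀ x) * E.π₁ T.e₁) (T.M.rep u T.Ω)
    (T.M.rep w T.Ω)
  refine h1.trans ?_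
  change ⟪E.incl (T.M.rep u T.Ω), E.π₁ T.e₁ ((y : E.L2 →L[ℂ] E.L2)
    (E.π₁ (T.ι₀ x) (E.π₁ T.e₁ (E.incl (T.M.rep w T.Ω)))))⟫_ℂ = _
  rw [π₁_e₁_incl, π₁_cornerVec, mul_one, ← ContinuousLinearMap.adjoint_inner_left,
    ← ContinuousLinearMap.star_eq_adjoint, star_π₁_e₁, π₁_e₁_incl]

/-- Since e₂ = V V⋆ for the embedding V, e₂ S e₂ = V (V⋆ S V) V⋆, and V intertwines the actions of
M. This makes the expectation in the definition of the convolution computable. -/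
theorem e₂_mul_mul_e₂ (y : E.M₂) (x : T.M) :
    E.e₂ * E.ι₁ T.e₁ * y * E.ι₂ x * E.ι₁ T.e₁ * E.e₂ = E.ι₂ (E.compressed y x) * E.e₂ := by
  refine Subtype.ext ?_
  ext v
  change E.e₂op (E.π₁ T.e₁ ((y : E.L2 →L[ℂ] E.L2) (E.π₁ (T.ι₀ x) (E.π₁ T.e₁ (E.e₂op v)))))
    = E.π₁ (T.ι₀ (E.compressed y x)) (E.e₂op v)
  rw [e₂op_apply E v, ← incl_apply, e₂op_apply]
  rfl

theorem norm_compress_le (S : E.L2 →L[ℂ] E.L2) : ‖E.compress S‖ ≤ ‖S‖ := by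
  have h1 : ‖E.incl‖ ≤ 1 := E.incl.opNorm_le_bound zero_le_one fun v => by
    rw [norm_incl, one_mul]
  have h2 : ‖ContinuousLinearMap.adjoint E.incl‖ ≤ 1 := by
    rwa [LinearIsometryEquiv.norm_map]
  calc ‖E.compress S‖ ≤ ‖ContinuousLinearMap.adjoint E.incl ∘L S‖ * ‖E.incl‖ :=
        ContinuousLinearMap.opNorm_comp_le _ _
    _ ≤ (‖ContinuousLinearMap.adjoint E.incl‖ * ‖S‖) * ‖E.incl‖ := by
        gcongr; exact ContinuousLinearMap.opNorm_comp_le _ _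
    _ ≤ (1 * ‖S‖) * 1 := by gcongr
    _ = ‖S‖ := by ring

theorem compress_add (S R : E.L2 →L[ℂ] E.L2) :
    E.compress (S + R) = E.compress S + E.compress R := by
  rw [compress, compress, compress, ContinuousLinearMap.comp_add, ContinuousLinearMap.add_comp]

theorem compress_smul (c : ℂ) (S : E.L2 →L[ℂ] E.L2) :
    E.compress (c • S) = c • E.compress S := by
  rw [compress, compress, ContinuousLinearMap.comp_smul, ContinuousLinearMap.smul_comp]

theorem compressed_add (y : E.M₂) (a b : T.M) :
    E.compressed y (a + b) = E.compressed y a + E.compressed y b := by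
  refine Subtype.ext ?_
  change E.compress _ = E.compress _ + E.compress _
  rw [← compress_add, map_add T.ι₀, map_add E.π₁, mul_add, add_mul]

theorem compressed_smul (y : E.M₂) (c : ℂ) (a : T.M) :
    E.compressed y (c • a) = c • E.compressed y a := by
  refine Subtype.ext ?_
  change E.compress _ = c • E.compress _
  rw [← compress_smul, map_smul T.ι₀, map_smul E.π₁, mul_smul_comm, smul_mul_assoc]

/-- `x ↦ e₁ y x e₁`, compressed to `L²(M)`, as a bounded linear map. -/
def compressedCLM (y : E.M₂) : T.M →L[ℂ] T.M :=
  LinearMap.mkContinuous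
    { toFun := E.compressed y
      map_add' := E.compressed_add y
      map_smul' := E.compressed_smul y }
    (‖E.π₁ T.e₁‖ * ‖(y : E.L2 →L[ℂ] E.L2)‖ * ‖E.π₁ T.e₁‖) fun x => by
      change ‖E.compress (E.π₁ T.e₁ * y * E.π₁ (T.ι₀ x) * E.π₁ T.e₁)‖ ≤ _
      refine (E.norm_compress_le _).trans ?_
      have h1 : ‖E.π₁ (T.ι₀ x)‖ ≤ ‖x‖ :=
        NonUnitalStarAlgHom.norm_apply_le (E.π₁.comp T.ι₀) x
      calc ‖E.π₁ T.e₁ * y * E.π₁ (T.ι₀ x) * E.π₁ T.e₁‖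
          ≤ ‖E.π₁ T.e₁‖ * ‖(y : E.L2 →L[ℂ] E.L2)‖ * ‖E.π₁ (T.ι₀ x)‖ * ‖E.π₁ T.e₁‖ := by
            refine (norm_mul_le _ _).trans ?_
            gcongr
            refine (norm_mul_le _ _).trans ?_
            gcongr
            exact norm_mul_le _ _
        _ ≤ ‖E.π₁ T.e₁‖ * ‖(y : E.L2 →L[ℂ] E.L2)‖ * ‖x‖ * ‖E.π₁ T.e₁‖ := by gcongr
        _ = _ := by ring

end LambdaExtension

section CondExp

variable {B C : Type*} [CStarAlgebra B] [CStarAlgebra C] [PartialOrder C]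
variable {φ : C →ₚ[ℂ] ℂ} {ι : B →⋆ₐ[ℂ] C} {e : C} {c : ℂ}

theorem map_mul_of_isCondExp_algebraMap (he : IsCondExp φ ι e (algebraMap ℂ B c)) (z : B) :
    φ (e * ι z) = c * φ (ι z) := by
  rw [← he z, AlgHomClass.commutes, Algebra.algebraMap_eq_smul_one, smul_mul_assoc, one_mul,
    map_smul, smul_eq_mul]

theorem IsCondExp.mul_of_map_mul (hφ : ∀ x y : C, φ (x * y) = φ (y * x))
    (he : ∀ z : B, φ (e * ι z) = c * φ (ι z)) (m : B) : IsCondExp φ ι (ι m * e) (c • m) := by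
  intro z
  rw [mul_assoc, hφ (ι m), mul_assoc, ← map_mul ι z, he, map_mul ι z, hφ (ι z), map_smul ι, smul_mul_assoc,
    map_smul, smul_eq_mul]

end CondExp

namespace JonesTower

variable {H : Type*} [NormedAddCommGroup H] [InnerProductSpace ℂ H] [CompleteSpace H]
variable {T : TracialInclusion H} (E : JonesTower T)

theorem τ₂_ι₂ (x : T.M) : E.τ₂ (E.ι₂ x) = T.τ x :=
  (E.extends_τ₁ (T.ι₀ x)).trans (E.extends_τ x)

/-- Faithfulness of τ makes the value of the expectation unique, so the chosen one is the one
exhibited. -/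
theorem expM_eq {y : E.M₂} {b : T.M} (hb : IsCondExp E.τ₂ E.ι₂ y b) : E.expM y = b := by
  have hex : ∃ b, IsCondExp E.τ₂ E.ι₂ y b := ⟨b, hb⟩
  have h1 : E.expM y = hex.choose := dif_pos hex
  rw [h1]
  refine TracialInclusion.ext_of_τ fun u => ?_
  have h2 : ∀ a z : T.M, E.τ₂ (E.ι₂ a * E.ι₂ z) = T.τ (a * z) := fun a z => by
    rw [← τ₂_ι₂, map_mul E.ι₂]
  rw [T.τ_comm, T.τ_comm _ b, ← h2, ← h2, hex.choose_spec, hb]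

theorem isCondExp_compressed (y : E.M₂) (x : T.M) :
    IsCondExp E.τ₂ E.ι₂ (E.e₂ * E.ι₁ T.e₁ * y * E.ι₂ x * E.ι₁ T.e₁ * E.e₂)
      ((E.lam : ℂ) • E.compressed y x) := by
  rw [E.e₂_mul_mul_e₂]
  have h : ∀ z : T.M, E.τ₂ (E.e₂ * E.ι₂ z) = (E.lam : ℂ) * E.τ₂ (E.ι₂ z) := by
    intro z
    have h1 := map_mul_of_isCondExp_algebraMap E.expectation₂ (T.ι₀ z)
    exact h1
  exact IsCondExp.mul_of_map_mul E.isTrace₂.trace h (E.compressed y x)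

/-- The expectation of e₂ contributes a factor lam, which turns the exponent -5/2 into -3/2; this
cancels the 3/2 in the definition of a Fourier multiplier. -/
theorem convolve_eq (x : T.M) (y : E.M₂) :
    E.convolve x y = ((E.lam ^ (-3 / 2 : ℝ) : ℝ) : ℂ) • E.compressed y x := by
  rw [convolve, E.expM_eq (E.isCondExp_compressed y x), smul_smul, ← Complex.ofReal_mul,
    ← Real.rpow_add_one E.lam_pos.ne']
  norm_num

/-- Every `y ∈ M' ∩ M₂` is the Fourier multiplier of `x ↦ x * y`. -/
theorem isFourierMultiplier_convolve {y : E.M₂} (hy : y ∈ E.relCommutant) :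
    E.IsFourierMultiplier (fun x => E.convolve x y) y := by
  refine ⟨hy, fun x₁ x₂ y₁ y₂ => ?_⟩
  change ⟪E.cornerVec x₂ y₂, (y : E.L2 →L[ℂ] E.L2) (E.cornerVec x₁ y₁)⟫_ℂ = _
  have h1 : E.cornerVec x₂ y₂ = E.π₁ (T.ι₀ x₂) (E.cornerVec 1 y₂) := by
    rw [E.π₁_cornerVec, mul_one]
  have h2 : E.π₁ (T.ι₀ (star x₂)) ((y : E.L2 →L[ℂ] E.L2) (E.cornerVec x₁ y₁))
      = (y : E.L2 →L[ℂ] E.L2) (E.cornerVec (star x₂ * x₁) y₁) := by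
    rw [← E.π₁_cornerVec]
    exact congrArg (fun S : E.M₂ => (S : E.L2 →L[ℂ] E.L2) (E.cornerVec x₁ y₁)) (hy (star x₂))
  rw [h1, inner_apply_star, ← map_star, h2, ← E.inner_compressed, apply_apply,
    LambdaExtension.inner_τ, ← mul_assoc]
  change _ = _ * T.τ (star y₂ * E.convolve (star x₂ * x₁) y * y₁)
  rw [convolve_eq, mul_smul_comm, smul_mul_assoc, T.τ_smul, ← mul_assoc, ← Complex.ofReal_mul,
    ← Real.rpow_add E.lam_pos]
  norm_num

end JonesTower

/-! ### Semigroups with bounded generators -/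

section Derivative

theorem hasDerivAt_exp_neg_smul_apply {X : Type*} [NormedAddCommGroup X] [NormedSpace ℂ X]
    [CompleteSpace X] (L : X →L[ℂ] X) (x : X) :
    HasDerivAt (fun t : ℝ => NormedSpace.exp ((-(t : ℂ)) • L) x) (-(L x)) 0 := by
  have h1 := hasDerivAt_exp_smul_const (𝕂 := ℂ) (-L) (((0 : ℝ) : ℂ))
  have h2 := h1.scomp (0 : ℝ) (hasDerivAt_id (0 : ℝ)).ofReal_comp
  have h3 : HasDerivAt (fun t : ℝ => NormedSpace.exp ((t : ℂ) • (-L)) x) ((NormedSpace.exp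
      (((0 : ℝ) : ℂ) • (-L)) * -L) x) 0 := by
    have h4 := ((ContinuousLinearMap.apply ℂ X x).restrictScalars
      ℝ).hasFDerivAt.comp_hasDerivAt (0 : ℝ) h2
    refine HasDerivAt.congr_deriv (f := fun t : ℝ => NormedSpace.exp ((t : ℂ) • (-L)) x) h4 ?_
    simp
  simpa [smul_neg, neg_smul] using h3

theorem exp_neg_zero_smul {X : Type*} [NormedAddCommGroup X] [NormedSpace ℂ X]
    [CompleteSpace X] (L : X →L[ℂ] X) : NormedSpace.exp ((-((0 : ℝ) : ℂ)) • L) = 1 := by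
  rw [Complex.ofReal_zero, neg_zero, zero_smul, NormedSpace.exp_zero]

/-- Identities for the semigroup hold only for t ≥ 0, whereas the exponentials are differentiable on
the whole line; one-sided agreement still determines the derivative at 0. -/
theorem deriv_eq_of_eqOn_Ici {X : Type*} [NormedAddCommGroup X] [NormedSpace ℝ X]
    {f g : ℝ → X} {f' g' : X} (hf : HasDerivAt f f' 0) (hg : HasDerivAt g g' 0)
    (h : ∀ t, 0 ≤ t → f t = g t) : f' = g' := by
  refine UniqueDiffWithinAt.eq_deriv (Set.Ici (0 : ℝ)) (uniqueDiffOn_Ici 0 0 Set.self_mem_Ici)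
    hf.hasDerivWithinAt ?_
  exact hg.hasDerivWithinAt.congr h (h 0 le_rfl)

theorem deriv_nonneg_of_nonneg {A : Type*} [CStarAlgebra A] [PartialOrder A] [StarOrderedRing A]
    {f : ℝ → A} {f' : A} (hf : HasDerivAt f f' 0) (h0 : f 0 = 0) (h : ∀ t, 0 ≤ t → 0 ≤ f t) :
    0 ≤ f' := by
  refine ge_of_tendsto hf.tendsto_slope_zero_right ?_
  filter_upwards [self_mem_nhdsWithin] with t ht
  have ht' : (0 : ℝ) < t := ht
  rw [zero_add, h0, sub_zero]
  exact smul_nonneg (inv_nonneg.2 ht'.le) (h t ht'.le)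

end Derivative

/-! ### Complete positivity and conditional negativity of the generator -/

section CompletelyPositive

open scoped CStarAlgebra

variable {A B : Type*} [CStarAlgebra A] [PartialOrder A] [StarOrderedRing A]
  [CStarAlgebra B] [PartialOrder B] [StarOrderedRing B]

theorem CStarMatrix.sum_nonneg {n : ℕ} {Z : CStarMatrix (Fin n) (Fin n) B} (hZ : 0 ≤ Z)
    (y : Fin n → B) : 0 ≤ ∑ i, ∑ j, star (y i) * Z i j * y j := by
  rw [StarOrderedRing.nonneg_iff] at hZ
  induction hZ using AddSubmonoid.closure_induction with
  | mem Z hZ =>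
    obtain ⟨Y, rfl⟩ := hZ
    have h : ∑ i, ∑ j, star (y i) * (star Y * Y) i j * y j
        = ∑ k, star (∑ i, Y k i * y i) * (∑ i, Y k i * y i) := by
      simp only [CStarMatrix.mul_apply, CStarMatrix.star_apply, star_sum, star_mul,
        Finset.sum_mul, Finset.mul_sum, mul_assoc]
      rw [Finset.sum_comm]
      refine (Finset.sum_congr rfl fun j _ => Finset.sum_comm).trans ?_
      exact Finset.sum_comm
    change 0 ≤ ∑ i, ∑ j, star (y i) * (star Y * Y) i j * y j
    rw [h]
    exact Finset.sum_nonneg fun k _ => star_mul_self_nonneg _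
  | zero => simp
  | add Z W _ _ hZ hW =>
    have h := add_nonneg hZ hW
    simp only [← Finset.sum_add_distrib] at h
    simpa only [CStarMatrix.add_apply, mul_add, add_mul] using h

theorem CompletelyPositiveMap.sum_nonneg (ψ : A →CP B) {n : ℕ} (x : Fin n → A) (y : Fin n → B) :
    0 ≤ ∑ i, ∑ j, star (y i) * ψ (star (x i) * x j) * y j := by
  rcases n with - | n
  · simp
  -- Only the row of index 0 is nonzero, so X⋆X has the entries x_i⋆ x_j.
  set X : CStarMatrix (Fin (n + 1)) (Fin (n + 1)) A :=
    CStarMatrix.ofMatrix (fun k j => if k = 0 then x j else 0) with hX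
  have hXa : ∀ k j, X k j = if k = 0 then x j else 0 := fun _ _ => rfl
  have h1 : 0 ≤ (star X * X).map ψ := ψ.map_cstarMatrix_nonneg _ (star_mul_self_nonneg X)
  have h2 : ∀ i j, (star X * X).map ψ i j = ψ (star (x i) * x j) := by
    intro i j
    rw [CStarMatrix.map_apply, CStarMatrix.mul_apply, Finset.sum_eq_single 0]
    · rw [CStarMatrix.star_apply, hXa, hXa, if_pos rfl, if_pos rfl]
    · intro k _ hk
      rw [hXa k j, if_neg hk, mul_zero]
    · simp
  simp only [← h2]
  exact CStarMatrix.sum_nonneg h1 y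

theorem CompletelyPositiveMap.map_star (ψ : A →CP B) (x : A) : ψ (star x) = star (ψ x) := by
  let φ : A →ₚ[ℂ] B := PositiveLinearMap.mk₀ ψ.toLinearMap fun a ha => map_nonneg ψ ha
  exact StarHomClass.map_star φ x

end CompletelyPositive

section Generator

variable {H : Type*} [NormedAddCommGroup H] [InnerProductSpace ℂ H] [CompleteSpace H]
variable {T : TracialInclusion H} {Φ : ℝ≥0 → (T.M →L[ℂ] T.M)} {L : T.M →L[ℂ] T.M}

theorem IsGenerator.eq (hL : IsGenerator Φ L) {t : ℝ} (ht : 0 ≤ t) :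
    NormedSpace.exp ((-(t : ℂ)) • L) = Φ t.toNNReal := by
  rw [hL, Real.coe_toNNReal t ht]

theorem IsGenerator.map_one (hL : IsGenerator Φ L) (hΦ : IsBimoduleQMS T Φ) : L 1 = 0 := by
  have h := deriv_eq_of_eqOn_Ici (hasDerivAt_exp_neg_smul_apply L 1)
    (hasDerivAt_const (0 : ℝ) (1 : T.M)) fun t ht => by rw [hL.eq ht, hΦ.unital]
  exact neg_eq_zero.1 h

theorem IsGenerator.map_star (hL : IsGenerator Φ L) (hΦ : IsBimoduleQMS T Φ) (x : T.M) :
    L (star x) = star (L x) := by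
  have h := deriv_eq_of_eqOn_Ici (hasDerivAt_exp_neg_smul_apply L (star x))
    (hasDerivAt_exp_neg_smul_apply L x).star fun t ht => by
      obtain ⟨ψ, hψ⟩ := hΦ.completelyPositive t.toNNReal
      rw [hL.eq ht, ← hψ, ← hψ, ψ.map_star]
  rw [star_neg] at h
  exact neg_injective h

theorem IsGenerator.bimodule (hL : IsGenerator Φ L) (hΦ : IsBimoduleQMS T Φ) {a b : T.M}
    (ha : a ∈ T.NinM) (hb : b ∈ T.NinM) (x : T.M) : L (a * x * b) = a * L x * b := by
  have h := deriv_eq_of_eqOn_Ici (hasDerivAt_exp_neg_smul_apply L (a * x * b))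
    (((hasDerivAt_exp_neg_smul_apply L x).const_mul a).mul_const b) fun t ht => by
      rw [hL.eq ht, hΦ.bimodule _ a ha b hb]
  rw [mul_neg, neg_mul] at h
  exact neg_injective h

theorem TracialInclusion.one_mem_NinM : (1 : T.M) ∈ T.NinM := one_mem T.N

theorem IsGenerator.mul_left (hL : IsGenerator Φ L) (hΦ : IsBimoduleQMS T Φ) {a : T.M}
    (ha : a ∈ T.NinM) (x : T.M) : L (a * x) = a * L x := by
  simpa using hL.bimodule hΦ ha T.one_mem_NinM x

theorem IsGenerator.mul_right (hL : IsGenerator Φ L) (hΦ : IsBimoduleQMS T Φ) {b : T.M}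
    (hb : b ∈ T.NinM) (x : T.M) : L (x * b) = L x * b := by
  simpa using hL.bimodule hΦ T.one_mem_NinM hb x

/-- The generator of a completely positive semigroup is conditionally negative. -/
theorem IsGenerator.sum_nonpos (hL : IsGenerator Φ L) (hΦ : IsBimoduleQMS T Φ) {n : ℕ}
    (x y : Fin n → T.M) (hxy : ∑ i, x i * y i = 0) :
    0 ≤ -∑ i, ∑ j, star (y i) * L (star (x i) * x j) * y j := by
  have h : HasDerivAt (fun t : ℝ => ∑ i, ∑ j, star (y i) *
      (NormedSpace.exp ((-(t : ℂ)) • L) (star (x i) * x j)) * y j)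
      (∑ i, ∑ j, star (y i) * (-(L (star (x i) * x j))) * y j) 0 :=
    HasDerivAt.fun_sum fun i _ => HasDerivAt.fun_sum fun j _ =>
      (((hasDerivAt_exp_neg_smul_apply L (star (x i) * x j)).const_mul _).mul_const _)
  have h1 := deriv_nonneg_of_nonneg h ?_ ?_
  · simpa [mul_neg, neg_mul, Finset.sum_neg_distrib] using h1
  -- At t = 0 the nonnegative sum is |∑ x_i y_i|² = 0, so its derivative there is nonnegative.
  · have h2 : ∑ i, ∑ j, star (y i) * (star (x i) * x j) * y j
        = star (∑ i, x i * y i) * ∑ i, x i * y i := by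
      simp only [star_sum, star_mul, Finset.sum_mul, Finset.mul_sum, mul_assoc]
      exact Finset.sum_comm
    rw [hxy, star_zero, zero_mul] at h2
    rw [exp_neg_zero_smul]
    exact h2
  · intro t ht
    obtain ⟨ψ, hψ⟩ := hΦ.completelyPositive t.toNNReal
    rw [hL.eq ht]
    simp only [← hψ]
    exact ψ.sum_nonneg x y

theorem TracialInclusion.τ_nonneg {a : T.M} (ha : 0 ≤ a) : 0 ≤ T.τ a := by
  have h : (0 : H →L[ℂ] H) ≤ a := ha
  rw [ContinuousLinearMap.nonneg_iff_isPositive] at h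
  exact h.inner_nonneg_right T.Ω

theorem TracialInclusion.τ_sum {ι : Type*} (s : Finset ι) (f : ι → T.M) :
    T.τ (∑ i ∈ s, f i) = ∑ i ∈ s, T.τ (f i) := by
  classical
  induction s using Finset.induction_on with
  | empty => simpa using T.τ_zero
  | insert a s ha ih => rw [Finset.sum_insert ha, Finset.sum_insert ha, T.τ_add, ih]

end Generator

/-! ### Kernels of positive operators and range projections -/

section Operators

variable {K : Type*} [NormedAddCommGroup K] [InnerProductSpace ℂ K] [CompleteSpace K]

theorem apply_eq_zero_of_inner_eq_zero {S : K →L[ℂ] K} (hS : 0 ≤ S) {v : K}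
    (hv : ⟪v, S v⟫_ℂ = 0) : S v = 0 := by
  obtain ⟨s, rfl⟩ := CStarAlgebra.nonneg_iff_eq_star_mul_self.1 hS
  change ⟪v, star s (s v)⟫_ℂ = 0 at hv
  rw [ContinuousLinearMap.star_eq_adjoint, ContinuousLinearMap.adjoint_inner_right,
    inner_self_eq_zero] at hv
  change star s (s v) = 0
  rw [hv, map_zero]

theorem rangeProjection_apply_eq_zero_iff {S : K →L[ℂ] K} {v : K} :
    rangeProjection S v = 0 ↔ star S v = 0 := by
  rw [rangeProjection, Submodule.starProjection_apply_eq_zero_iff,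
    Submodule.orthogonal_closure, Submodule.mem_orthogonal]
  constructor
  · intro h
    refine ext_inner_left ℂ fun u => ?_
    rw [ContinuousLinearMap.star_eq_adjoint, ContinuousLinearMap.adjoint_inner_right,
      inner_zero_right]
    exact h _ ⟨u, rfl⟩
  · rintro h _ ⟨u, rfl⟩
    change ⟪S u, v⟫_ℂ = 0
    rw [← ContinuousLinearMap.adjoint_inner_right, ← ContinuousLinearMap.star_eq_adjoint, h,
      inner_zero_right]

theorem nonneg_of_inner_nonneg {K : Type*} [NormedAddCommGroup K] [InnerProductSpace ℂ K]
    {S : K →L[ℂ] K} (h : ∀ v, 0 ≤ ⟪v, S v⟫_ℂ) : 0 ≤ S := by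
  rw [ContinuousLinearMap.nonneg_iff_isPositive, ContinuousLinearMap.isPositive_iff_complex]
  intro v
  have h1 := Complex.le_def.1 (h v)
  have h2 : ⟪S v, v⟫_ℂ = ⟪v, S v⟫_ℂ := by
    rw [← inner_conj_symm, Complex.conj_eq_iff_im]
    exact h1.2.symm
  rw [h2]
  exact ⟨Complex.ext rfl h1.2, h1.1⟩

end Operators

/-! ### Commutator vectors and the quadratic form of a Fourier multiplier -/

namespace LambdaExtension

variable {H : Type*} [NormedAddCommGroup H] [InnerProductSpace ℂ H] [CompleteSpace H]
variable {T : TracialInclusion H} (E : LambdaExtension T)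

/-- The vector `(x e₁ - e₁ x) Ω₁`. -/
def commVec (x : T.M) : E.L2 := E.cornerVec x 1 - E.cornerVec 1 x

theorem e₂op_commVec (x : T.M) : E.e₂op (E.commVec x) = 0 := by
  rw [commVec, map_sub, e₂op_cornerVec, e₂op_cornerVec, mul_one, one_mul, sub_self]

theorem J₁_commVec (x : T.M) : E.J₁ (E.commVec x) = -E.commVec (star x) := by
  rw [commVec, commVec, map_sub, J₁_cornerVec, J₁_cornerVec, star_one, neg_sub]

theorem commVec_of_mem {x : T.M} (hx : x ∈ T.NinM) : E.commVec x = 0 := by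
  rw [commVec, cornerVec, cornerVec, map_one, mul_one, one_mul, T.commute_e₁ hx, sub_self]

variable {E}

theorem IsFourierMultiplier.inner_cornerVec {F : T.M → T.M} {y : E.M₂}
    (h : E.IsFourierMultiplier F y) (x₁ x₂ y₁ y₂ : T.M) :
    ⟪E.cornerVec x₂ y₂, (y : E.L2 →L[ℂ] E.L2) (E.cornerVec x₁ y₁)⟫_ℂ
      = ((E.lam ^ (3 / 2 : ℝ) : ℝ) : ℂ) * T.τ (star y₂ * F (star x₂ * x₁) * y₁) :=
  h.2 x₁ x₂ y₁ y₂

/-- The link between multipliers and gradient forms: the expression inside the trace is -2Γ(x, x)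
when F is the generator. -/
theorem IsFourierMultiplier.inner_commVec {F : T.M → T.M} {y : E.M₂}
    (h : E.IsFourierMultiplier F y) (x : T.M) :
    ⟪E.commVec x, (y : E.L2 →L[ℂ] E.L2) (E.commVec x)⟫_ℂ
      = ((E.lam ^ (3 / 2 : ℝ) : ℝ) : ℂ) *
        T.τ (F (star x * x) - star x * F x - F (star x) * x + star x * F 1 * x) := by
  rw [commVec, map_sub, inner_sub_left, inner_sub_right, inner_sub_right, h.inner_cornerVec,
    h.inner_cornerVec, h.inner_cornerVec, h.inner_cornerVec, T.τ_add, T.τ_sub, T.τ_sub]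
  simp only [star_one, one_mul, mul_one]
  ring

theorem lam_rpow_ne_zero : ((E.lam ^ (3 / 2 : ℝ) : ℝ) : ℂ) ≠ 0 := by
  exact_mod_cast (Real.rpow_pos_of_pos E.lam_pos _).ne'

theorem lam_rpow_nonneg : (0 : ℂ) ≤ ((E.lam ^ (3 / 2 : ℝ) : ℝ) : ℂ) := by
  exact_mod_cast (Real.rpow_pos_of_pos E.lam_pos _).le

theorem IsFourierMultiplier.apply_star {F : T.M → T.M} {y : E.M₂}
    (h : E.IsFourierMultiplier F y) (hy : IsSelfAdjoint (y : E.L2 →L[ℂ] E.L2)) (x : T.M) :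
    F (star x) = star (F x) := by
  refine T.ext_of_τ fun u => ?_
  have h1 := h.inner_cornerVec (star x) 1 1 u
  have h2 := h.inner_cornerVec x 1 u 1
  have h3 : E.cornerVec (star x) 1 = E.π₁ (T.ι₀ (star x)) (E.cornerVec 1 1) := by
    rw [E.π₁_cornerVec, mul_one]
  have hcomm : ∀ (z : T.M) (v : E.L2), (y : E.L2 →L[ℂ] E.L2) (E.π₁ (T.ι₀ z) v)
      = E.π₁ (T.ι₀ z) ((y : E.L2 →L[ℂ] E.L2) v) := fun z v =>
    (congrArg (fun S : E.M₂ => (S : E.L2 →L[ℂ] E.L2) v) (h.1 z)).symm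
  have hadj : ContinuousLinearMap.adjoint (y : E.L2 →L[ℂ] E.L2) = y := hy.star_eq
  have h4 : ⟪E.cornerVec 1 u, (y : E.L2 →L[ℂ] E.L2) (E.cornerVec (star x) 1)⟫_ℂ
      = starRingEnd ℂ ⟪E.cornerVec 1 1, (y : E.L2 →L[ℂ] E.L2) (E.cornerVec x u)⟫_ℂ := by
    rw [h3, hcomm, map_star T.ι₀, ← inner_apply_star, E.π₁_cornerVec, mul_one, inner_conj_symm,
      ← ContinuousLinearMap.adjoint_inner_left, hadj]
  rw [h1, h2, map_mul, Complex.conj_ofReal] at h4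
  have h5 := mul_left_cancel₀ lam_rpow_ne_zero h4
  simp only [star_one, one_mul, mul_one] at h5
  rw [h5]
  have h6 : T.τ (F x * u) = ⟪T.M.rep (star (F x)) T.Ω, T.M.rep u T.Ω⟫_ℂ := by
    rw [inner_τ, star_star]
  rw [h6, inner_conj_symm, inner_τ]

/-- The multiplier does not distinguish x e₁ Ω₁ from e₁ x Ω₁; paired with e₁ u Ω₁, the first gives
τ(u⋆F(x)) and the second τ(u⋆F(1)x). -/
theorem IsFourierMultiplier.eq_map_one_mul {F : T.M → T.M} {y : E.M₂}
    (h : E.IsFourierMultiplier F y) {x : T.M}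
    (hx : (y : E.L2 →L[ℂ] E.L2) (E.commVec x) = 0) : F x = F 1 * x := by
  refine T.ext_of_τ fun u => mul_left_cancel₀ (lam_rpow_ne_zero (E := E)) ?_
  have h1 := h.inner_cornerVec x 1 1 u
  have h2 := h.inner_cornerVec 1 1 x u
  have h3 : (y : E.L2 →L[ℂ] E.L2) (E.cornerVec x 1) = (y : E.L2 →L[ℂ] E.L2) (E.cornerVec 1 x) := by
    rw [commVec, map_sub] at hx
    exact sub_eq_zero.1 hx
  rw [h3, h2] at h1
  simpa [mul_assoc] using h1.symm

theorem exists_eq_sum_cornerVec {v : E.L2} (hv : v ∈ E.cornerSpace) :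
    ∃ (n : ℕ) (x y : Fin n → T.M), v = ∑ i, E.cornerVec (x i) (y i) := by
  obtain ⟨a, ha, rfl⟩ := Submodule.mem_map.1 hv
  obtain ⟨n, f, g, rfl⟩ := Submodule.mem_span_set'.1 ha
  have hg : ∀ i, ∃ p : T.M × T.M, T.ι₀ p.1 * T.e₁ * T.ι₀ p.2 = g i := fun i => (g i).2
  choose p hp using hg
  refine ⟨n, fun i => f i • (p i).1, fun i => (p i).2, ?_⟩
  rw [map_sum]
  refine Finset.sum_congr rfl fun i _ => ?_
  rw [orbitMap_apply, cornerVec, ← hp i, map_smul T.ι₀, smul_mul_assoc, smul_mul_assoc]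

theorem rightMul_e₁_mem_cornerSpace (x : T.M) :
    rightMul E.π₁ E.Ω₁ T.e₁ (E.π₁ (T.ι₀ x) E.Ω₁) ∈ E.cornerSpace := by
  rw [E.isTraceVector.rightMul_orbit]
  refine Submodule.mem_map.2 ⟨T.ι₀ x * T.e₁ * T.ι₀ 1, T.mem_basicIdeal x 1, ?_⟩
  rw [orbitMap_apply, map_one, mul_one]

/-- Every vector orthogonal to `L²(M)` is a limit of vectors in the span of `M e₁ M Ω₁` which are
orthogonal to `L²(M)`. -/
theorem mem_closure_ker_e₂op {v : E.L2} (hv : E.e₂op v = 0) :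
    v ∈ closure {w | w ∈ E.cornerSpace ∧ E.e₂op w = 0} := by
  set R : E.L2 →L[ℂ] E.L2 := rightMul E.π₁ E.Ω₁ T.e₁ with hR
  -- A bounded correction which fixes ker e₂ and maps ∑ x_i e₁ y_i Ω₁ to the same sum minus (∑ x_i
  -- y_i) e₁ Ω₁. Hence it sends the dense span into itself and into ker e₂, which 1 - e₂ is not
  -- known to do.
  set C : E.L2 →L[ℂ] E.L2 := 1 - (E.lam : ℂ)⁻¹ • (R * E.e₂op) with hC
  have hCa : ∀ w, C w = w - (E.lam : ℂ)⁻¹ • R (E.e₂op w) := fun w => rfl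
  have hlam : (E.lam : ℂ) ≠ 0 := by exact_mod_cast E.lam_pos.ne'
  have hCv : C v = v := by rw [hCa, hv, map_zero, smul_zero, sub_zero]
  rw [← hCv]
  refine map_mem_closure C.continuous (E.dense_cornerSpace v) fun w hw => ?_
  obtain ⟨n, x, y, rfl⟩ := exists_eq_sum_cornerVec hw
  have h1 : E.e₂op (∑ i, E.cornerVec (x i) (y i))
      = (E.lam : ℂ) • E.π₁ (T.ι₀ (∑ i, x i * y i)) E.Ω₁ := by
    rw [map_sum]
    simp only [e₂op_cornerVec]
    rw [← Finset.smul_sum, map_sum T.ι₀, map_sum E.π₁, sum_apply]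
  have h2 : R (E.e₂op (∑ i, E.cornerVec (x i) (y i)))
      = (E.lam : ℂ) • E.cornerVec (∑ i, x i * y i) 1 := by
    rw [h1, map_smul, hR, E.isTraceVector.rightMul_orbit, cornerVec, map_one, mul_one]
  refine ⟨?_, ?_⟩
  · rw [hCa, h1, map_smul]
    exact sub_mem hw (Submodule.smul_mem _ _ (Submodule.smul_mem _ _
      (rightMul_e₁_mem_cornerSpace _)))
  · rw [hCa, h2, inv_smul_smul₀ hlam, map_sub, h1, e₂op_cornerVec, mul_one, sub_self]

/-- The Fourier multiplier of the generator is negative on the orthogonal complement of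
`L²(M)`. -/
theorem IsFourierMultiplier.neg_inner_nonneg {Φ : ℝ≥0 → (T.M →L[ℂ] T.M)} {L : T.M →L[ℂ] T.M}
    {y : E.M₂} (h : E.IsFourierMultiplier L y) (hΦ : IsBimoduleQMS T Φ) (hL : IsGenerator Φ L)
    {v : E.L2} (hv : E.e₂op v = 0) : 0 ≤ -⟪v, (y : E.L2 →L[ℂ] E.L2) v⟫_ℂ := by
  have hclosed : IsClosed {v : E.L2 | 0 ≤ -⟪v, (y : E.L2 →L[ℂ] E.L2) v⟫_ℂ} :=
    isClosed_le continuous_const (by fun_prop)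
  refine closure_minimal ?_ hclosed (mem_closure_ker_e₂op hv)
  rintro w ⟨hw, hw0⟩
  obtain ⟨n, x, z, rfl⟩ := exists_eq_sum_cornerVec hw
  have hlam : (E.lam : ℂ) ≠ 0 := by exact_mod_cast E.lam_pos.ne'
  -- Orthogonality to L²(M) is exactly the constraint under which the generator is conditionally
  -- negative.
  have hxz : ∑ i, x i * z i = 0 := by
    have h1 : ContinuousLinearMap.adjoint E.incl (∑ i, E.cornerVec (x i) (z i))
        = (E.lam : ℂ) • T.M.rep (∑ i, x i * z i) T.Ω := by
      rw [map_sum]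
      simp only [adjoint_incl_cornerVec]
      rw [← Finset.smul_sum, map_sum T.M.rep, sum_apply]
    rw [e₂op_apply, h1] at hw0
    have h2 := congrArg norm hw0
    rw [norm_incl, norm_zero, norm_eq_zero, smul_eq_zero] at h2
    refine T.ext_of_orbit ((h2.resolve_left hlam).trans ?_)
    rw [map_zero]
    rfl
  have h1 : ⟪∑ i, E.cornerVec (x i) (z i), (y : E.L2 →L[ℂ] E.L2) (∑ i, E.cornerVec (x i) (z i))⟫_ℂ
      = ((E.lam ^ (3 / 2 : ℝ) : ℝ) : ℂ) *
        T.τ (∑ i, ∑ j, star (z i) * L (star (x i) * x j) * z j) := by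
    rw [map_sum, sum_inner, T.τ_sum, Finset.mul_sum]
    refine Finset.sum_congr rfl fun i _ => ?_
    rw [inner_sum, T.τ_sum, Finset.mul_sum]
    exact Finset.sum_congr rfl fun j _ => h.inner_cornerVec _ _ _ _
  change 0 ≤ -⟪∑ i, E.cornerVec (x i) (z i),
    (y : E.L2 →L[ℂ] E.L2) (∑ i, E.cornerVec (x i) (z i))⟫_ℂ
  rw [h1, ← mul_neg, ← T.τ_neg]
  exact mul_nonneg lam_rpow_nonneg (T.τ_nonneg (hL.sum_nonpos hΦ x z hxz))

/-- The kernel of `y ≥ 0` is invariant under `J₁` if `y` and its contragredient have the same range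
projection. -/
theorem apply_J₁_eq_zero {y : E.L2 →L[ℂ] E.L2} (hy : IsSelfAdjoint y)
    (hr : rangeProjection (E.contragredient y) = rangeProjection y) {v : E.L2} (hv : y v = 0) :
    y (E.J₁ v) = 0 := by
  -- The range projection of a self-adjoint operator has the same kernel as the operator, and the
  -- kernel of the contragredient is J₁ applied to ker y.
  have h1 : rangeProjection y v = 0 := by rw [rangeProjection_apply_eq_zero_iff, hy.star_eq, hv]
  have h2 : star (conjOp E.π₁ E.Ω₁ (star y)) v = 0 := by
    rw [← hr] at h1
    exact rangeProjection_apply_eq_zero_iff.1 h1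
  rw [← E.isTraceVector.conjOp_star, star_star, conjOp_apply] at h2
  have h3 := congrArg (modularConjugation E.π₁ E.Ω₁) h2
  rwa [E.isTraceVector.modularConjugation_involutive, map_zero] at h3

end LambdaExtension

theorem tsum_eq_exp_smul_apply {X : Type*} [NormedAddCommGroup X] [NormedSpace ℂ X]
    [CompleteSpace X] (L : X →L[ℂ] X) (c : ℂ) (x : X) :
    ∑' n : ℕ, (c ^ n / (n.factorial : ℂ)) • (L : X → X)^[n] x = NormedSpace.exp (c • L) x := by
  have h1 := NormedSpace.exp_series_hasSum_exp' (𝕂 := ℂ) (c • L)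
  have h2 := h1.mapL (ContinuousLinearMap.apply ℂ X x)
  refine HasSum.tsum_eq (h2.congr_fun ?_)
  intro n
  rw [ContinuousLinearMap.apply_apply, smul_pow, smul_smul]
  change _ = (((n.factorial : ℂ)⁻¹ * c ^ n) • (L ^ n) x)
  have hp : (L ^ n) x = (L : X → X)^[n] x := by
    induction n with
    | zero => rfl
    | succ k ih =>
      rw [Function.iterate_succ_apply', ← ih, pow_succ']
      rfl
  rw [hp, div_eq_inv_mul]

/-! ### Positivity of L̂₀, the Laplacian and its kernel -/

namespace JonesTower

variable {H : Type*} [NormedAddCommGroup H] [InnerProductSpace ℂ H] [CompleteSpace H]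
variable {T : TracialInclusion H} (E : JonesTower T)

theorem Lhat₀_mem_relCommutant {L : T.M →L[ℂ] T.M}
    (h : E.fourierMultiplier L ∈ E.relCommutant) : E.Lhat₀ L ∈ E.relCommutant := by
  intro x
  have h1 : Commute (E.ι₂ x) (1 - E.e₂) :=
    (Commute.one_right _).sub_right (E.e₂_mem_relCommutant x)
  exact ((h1.mul_right (h x)).mul_right h1).neg_right

theorem fourierMultiplier_eq_zero {F : T.M → T.M}
    (h : ¬ ∃ y, E.IsFourierMultiplier F y) : E.fourierMultiplier F = 0 := dif_neg h

theorem isFourierMultiplier_fourierMultiplier {F : T.M → T.M}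
    (h : ∃ y, E.IsFourierMultiplier F y) : E.IsFourierMultiplier F (E.fourierMultiplier F) := by
  have h1 : E.fourierMultiplier F = h.choose := dif_pos h
  rw [h1]
  exact h.choose_spec

theorem fourierMultiplier_mem_relCommutant (F : T.M → T.M) :
    E.fourierMultiplier F ∈ E.relCommutant := by
  by_cases h : ∃ y, E.IsFourierMultiplier F y
  · exact (E.isFourierMultiplier_fourierMultiplier h).1
  · rw [E.fourierMultiplier_eq_zero h]
    intro x
    rw [mul_zero, zero_mul]

theorem Lhat₀_apply (L : T.M →L[ℂ] T.M) (v : E.L2) :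
    (E.Lhat₀ L : E.L2 →L[ℂ] E.L2) v = -((E.fourierMultiplier L : E.L2 →L[ℂ] E.L2) (v - E.e₂op v)
      - E.e₂op ((E.fourierMultiplier L : E.L2 →L[ℂ] E.L2) (v - E.e₂op v))) := rfl

theorem inner_Lhat₀ (L : T.M →L[ℂ] T.M) (v : E.L2) :
    ⟪v, (E.Lhat₀ L : E.L2 →L[ℂ] E.L2) v⟫_ℂ
      = -⟪v - E.e₂op v, (E.fourierMultiplier L : E.L2 →L[ℂ] E.L2) (v - E.e₂op v)⟫_ℂ := by
  have h1 : ContinuousLinearMap.adjoint E.e₂op = E.e₂op := E.e₂op_isSelfAdjoint.star_eq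
  rw [Lhat₀_apply, inner_neg_right, inner_sub_right, inner_sub_left,
    ← ContinuousLinearMap.adjoint_inner_left E.e₂op, h1]

/-- `fourierMultiplier` defaults to 0, so the case without a multiplier can be treated directly and
existence need not be proved. -/
theorem Lhat₀_eq_zero {L : T.M →L[ℂ] T.M} (h : ¬ ∃ y, E.IsFourierMultiplier L y) :
    (E.Lhat₀ L : E.L2 →L[ℂ] E.L2) = 0 := by
  ext v
  rw [Lhat₀_apply, E.fourierMultiplier_eq_zero h]
  change -((0 : E.L2) - E.e₂op 0) = 0
  simp

/-- The operator `L̂₀` is positive. -/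
theorem Lhat₀_nonneg {Φ : ℝ≥0 → (T.M →L[ℂ] T.M)} {L : T.M →L[ℂ] T.M}
    (hΦ : IsBimoduleQMS T Φ) (hL : IsGenerator Φ L) :
    0 ≤ (E.Lhat₀ L : E.L2 →L[ℂ] E.L2) := by
  by_cases h : ∃ y, E.IsFourierMultiplier L y
  · refine nonneg_of_inner_nonneg fun v => ?_
    rw [inner_Lhat₀]
    refine (E.isFourierMultiplier_fourierMultiplier h).neg_inner_nonneg hΦ hL ?_
    rw [map_sub, E.e₂op_apply v, E.e₂op_incl, sub_self]
  · rw [E.Lhat₀_eq_zero h]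

/-- `Γ(x, x) = 0` implies that `L̂₀` annihilates `(x e₁ - e₁ x) Ω₁`. -/
theorem Lhat₀_commVec_of_gradientForm {Φ : ℝ≥0 → (T.M →L[ℂ] T.M)} {L : T.M →L[ℂ] T.M}
    (hΦ : IsBimoduleQMS T Φ) (hL : IsGenerator Φ L) {x : T.M} (hx : gradientForm L x x = 0) :
    (E.Lhat₀ L : E.L2 →L[ℂ] E.L2) (E.commVec x) = 0 := by
  by_cases h : ∃ y, E.IsFourierMultiplier L y
  · refine apply_eq_zero_of_inner_eq_zero (E.Lhat₀_nonneg hΦ hL) ?_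
    rw [inner_Lhat₀, E.e₂op_commVec, sub_zero,
      (E.isFourierMultiplier_fourierMultiplier h).inner_commVec, hL.map_one hΦ, hL.map_star hΦ]
    rw [gradientForm, smul_eq_zero] at hx
    have h1 := hx.resolve_left (by norm_num)
    have h2 : L (star x * x) - star x * L x - star (L x) * x + star x * 0 * x
        = -(star x * L x + star (L x) * x - L (star x * x)) := by
      rw [mul_zero, zero_mul]; abel
    rw [h2, h1, neg_zero, T.τ_zero, mul_zero, neg_zero]
  · rw [E.Lhat₀_eq_zero h]
    rfl

/-- The Laplacian as a bounded linear map. -/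
def laplacianCLM (L : T.M →L[ℂ] T.M) : T.M →L[ℂ] T.M :=
  (1 / 2 : ℂ) • ContinuousLinearMap.mul ℂ T.M (E.convolve 1 (E.Lhat₀ L))
    + (1 / 2 : ℂ) • (ContinuousLinearMap.mul ℂ T.M).flip (E.convolve 1 (E.Lhat₀ L))
    - ((E.lam ^ (-3 / 2 : ℝ) : ℝ) : ℂ) • E.compressedCLM (E.Lhat₀ L)

theorem laplacianCLM_apply (L : T.M →L[ℂ] T.M) (x : T.M) :
    E.laplacianCLM L x = E.laplacian L x := by
  rw [laplacian, E.convolve_eq x]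
  rfl

theorem laplacianSemigroup_eq (L : T.M →L[ℂ] T.M) (t : ℝ≥0) (x : T.M) :
    E.laplacianSemigroup L t x
      = NormedSpace.exp ((-((t : ℝ) : ℂ)) • E.laplacianCLM L) x := by
  rw [← tsum_eq_exp_smul_apply, laplacianSemigroup]
  have h : (E.laplacianCLM L : T.M → T.M) = E.laplacian L := funext (E.laplacianCLM_apply L)
  rw [h]

theorem mem_fixedPoints_of_laplacian {L : T.M →L[ℂ] T.M} {x : T.M} (hx : E.laplacian L x = 0) :
    x ∈ fixedPoints (E.laplacianSemigroup L) := by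
  have h0 : E.laplacian L 0 = 0 := by rw [← laplacianCLM_apply, map_zero]
  have hn : ∀ n : ℕ, (E.laplacian L)^[n + 1] x = 0 := by
    intro n
    rw [Function.iterate_succ_apply, hx]
    exact Function.iterate_fixed h0 n
  intro t
  rw [laplacianSemigroup, tsum_eq_single 0]
  · simp
  · intro n hn0
    obtain ⟨m, rfl⟩ := Nat.exists_eq_succ_of_ne_zero hn0
    rw [hn, smul_zero]

variable {Φ : ℝ≥0 → (T.M →L[ℂ] T.M)} {L : T.M →L[ℂ] T.M}

theorem isFourierMultiplier_Lhat₀ :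
    E.IsFourierMultiplier (fun x => E.convolve x (E.Lhat₀ L)) (E.Lhat₀ L) :=
  E.isFourierMultiplier_convolve
    (E.Lhat₀_mem_relCommutant (E.fourierMultiplier_mem_relCommutant L))

theorem convolve_star (h0 : 0 ≤ (E.Lhat₀ L : E.L2 →L[ℂ] E.L2)) (x : T.M) :
    E.convolve (star x) (E.Lhat₀ L) = star (E.convolve x (E.Lhat₀ L)) :=
  (E.isFourierMultiplier_Lhat₀ (L := L)).apply_star (IsSelfAdjoint.of_nonneg h0) x

theorem star_convolve_one (h0 : 0 ≤ (E.Lhat₀ L : E.L2 →L[ℂ] E.L2)) :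
    star (E.convolve 1 (E.Lhat₀ L)) = E.convolve 1 (E.Lhat₀ L) := by
  rw [← E.convolve_star h0, star_one]

/-- The condition at x gives x * L̂₀ = (1 * L̂₀)x. The one at x⋆, after taking adjoints, gives x *
L̂₀ = x(1 * L̂₀). The two halves of the anticommutator then cancel the convolution. -/
theorem laplacian_eq_zero (h0 : 0 ≤ (E.Lhat₀ L : E.L2 →L[ℂ] E.L2)) {x : T.M}
    (hx : (E.Lhat₀ L : E.L2 →L[ℂ] E.L2) (E.commVec x) = 0)
    (hx' : (E.Lhat₀ L : E.L2 →L[ℂ] E.L2) (E.commVec (star x)) = 0) : E.laplacian L x = 0 := by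
  have hF := E.isFourierMultiplier_Lhat₀ (L := L)
  have h1 : E.convolve x (E.Lhat₀ L) = E.convolve 1 (E.Lhat₀ L) * x := hF.eq_map_one_mul hx
  have h2 : E.convolve (star x) (E.Lhat₀ L) = E.convolve 1 (E.Lhat₀ L) * star x :=
    hF.eq_map_one_mul hx'
  have h3 : E.convolve x (E.Lhat₀ L) = x * E.convolve 1 (E.Lhat₀ L) := by
    have h4 := E.convolve_star h0 (star x)
    rwa [h2, star_mul, star_star, E.star_convolve_one h0] at h4
  rw [laplacian, ← h1, ← h3, ← add_smul]
  norm_num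

theorem laplacian_eq_zero_of_mem (h0 : 0 ≤ (E.Lhat₀ L : E.L2 →L[ℂ] E.L2)) {x : T.M}
    (hx : x ∈ T.NinM) : E.laplacian L x = 0 := by
  refine E.laplacian_eq_zero h0 ?_ ?_
  · rw [E.commVec_of_mem hx, map_zero]
  · rw [E.commVec_of_mem (T.star_mem_elementsOf T.N x hx), map_zero]

/-- If the carré du champ of the Laplacian vanishes at `x`, then `L̂₀` annihilates
`(x e₁ - e₁ x) Ω₁`. -/
theorem Lhat₀_commVec_of_laplacian (h0 : 0 ≤ (E.Lhat₀ L : E.L2 →L[ℂ] E.L2)) {x : T.M}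
    (hx : E.laplacian L (star x) * x + star x * E.laplacian L x = E.laplacian L (star x * x)) :
    (E.Lhat₀ L : E.L2 →L[ℂ] E.L2) (E.commVec x) = 0 := by
  refine apply_eq_zero_of_inner_eq_zero h0 ?_
  rw [(E.isFourierMultiplier_Lhat₀ (L := L)).inner_commVec]
  set k := E.convolve 1 (E.Lhat₀ L) with hk
  have h1 : E.convolve (star x * x) (E.Lhat₀ L) - star x * E.convolve x (E.Lhat₀ L)
      - E.convolve (star x) (E.Lhat₀ L) * x + star x * k * x
      = E.laplacian L (star x) * x + star x * E.laplacian L x - E.laplacian L (star x * x) := by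
    have h2 : star x * k * x = (1 / 2 : ℂ) • (star x * k * x) + (1 / 2 : ℂ) • (star x * k * x) := by
      rw [← add_smul]; norm_num
    rw [laplacian, laplacian, laplacian, ← hk, h2]
    simp only [sub_mul, add_mul, mul_sub, mul_add, smul_mul_assoc, mul_smul_comm, mul_assoc]
    abel
  rw [h1, hx, sub_self, T.τ_zero, mul_zero]

/-- The derivative at t = 0 of the multiplicativity identity, by the Leibniz rule. -/
theorem laplacian_of_mul_eq {x : T.M}
    (hx : ∀ t, E.laplacianSemigroup L t (star x) * E.laplacianSemigroup L t x
      = E.laplacianSemigroup L t (star x * x)) :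
    E.laplacian L (star x) * x + star x * E.laplacian L x = E.laplacian L (star x * x) := by
  set S := E.laplacianCLM L with hS
  have h := deriv_eq_of_eqOn_Ici
    ((hasDerivAt_exp_neg_smul_apply S (star x)).mul (hasDerivAt_exp_neg_smul_apply S x))
    (hasDerivAt_exp_neg_smul_apply S (star x * x)) fun t ht => by
      have h1 := hx t.toNNReal
      simp only [laplacianSemigroup_eq, Real.coe_toNNReal t ht] at h1
      exact h1
  rw [exp_neg_zero_smul] at h
  change -(S (star x)) * x + star x * -(S x) = -(S (star x * x)) at h
  rw [neg_mul, mul_neg, ← neg_add, neg_inj] at h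
  simpa only [hS, laplacianCLM_apply] using h

end JonesTower

end

theorem mainTheorem9 {H : Type*} [NormedAddCommGroup H] [InnerProductSpace ℂ H] [CompleteSpace H]
    (T : TracialInclusion H) (E : JonesTower T)
    (Φ : ℝ≥0 → (T.M →L[ℂ] T.M)) (hΦ : IsBimoduleQMS T Φ)
    (L : T.M →L[ℂ] T.M) (hL : IsGenerator Φ L)
    (Δ : E.M₂) (hKMS : E.IsBimoduleKMSSymmetric L Δ) (herg : E.IsRelativelyErgodic L) :
    {x : T.M | gradientForm L x x = 0} = {x : T.M | ∀ y : T.M, gradientForm L x y = 0} ∧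
    {x : T.M | gradientForm L x x = 0} = {x : T.M | E.laplacian L x = 0} ∧
    {x : T.M | E.laplacian L x = 0} = multiplicativeDomain (E.laplacianSemigroup L) ∧
    multiplicativeDomain (E.laplacianSemigroup L) = fixedPoints (E.laplacianSemigroup L) ∧
    fixedPoints (E.laplacianSemigroup L) = T.NinM := by
  have h0 := E.Lhat₀_nonneg hΦ hL
  have hfix := herg.fixedPoints_eq
  have hker : {x : T.M | E.laplacian L x = 0} = T.NinM := by
    refine Set.Subset.antisymm (fun x hx => ?_) fun x hx => E.laplacian_eq_zero_of_mem h0 hx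
    rw [← hfix]
    exact E.mem_fixedPoints_of_laplacian hx
  have hmult : multiplicativeDomain (E.laplacianSemigroup L) = T.NinM := by
    refine Set.Subset.antisymm (fun x hx => ?_) fun x hx t => ?_
    · rw [← hker]
      refine E.laplacian_eq_zero h0 ?_ ?_
      · exact E.Lhat₀_commVec_of_laplacian h0 (E.laplacian_of_mul_eq fun t => (hx t).1)
      · refine E.Lhat₀_commVec_of_laplacian h0 (E.laplacian_of_mul_eq fun t => ?_)
        rw [star_star]
        exact (hx t).2
    · have hs := T.star_mem_elementsOf T.N x hx
      have hfix' : ∀ z ∈ T.NinM, E.laplacianSemigroup L t z = z := by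
        rw [← hfix]
        exact fun z hz => hz t
      rw [hfix' x hx, hfix' _ hs, hfix' _ (T.mul_mem_elementsOf T.N _ hs _ hx),
        hfix' _ (T.mul_mem_elementsOf T.N _ hx _ hs)]
      exact ⟨rfl, rfl⟩
  have hgrad : ∀ x, gradientForm L x x = 0 → x ∈ T.NinM := by
    intro x hx
    have h1 := E.Lhat₀_commVec_of_gradientForm hΦ hL hx
    -- The gradient form gives information only at x; J₁-invariance of ker L̂₀ transfers it to x⋆.
    have h2 := E.apply_J₁_eq_zero (IsSelfAdjoint.of_nonneg h0) herg.range_eq h1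
    rw [E.J₁_commVec, map_neg, neg_eq_zero] at h2
    rw [← hker]
    exact E.laplacian_eq_zero h0 h1 h2
  have hgrad' : ∀ x ∈ T.NinM, ∀ y, gradientForm L x y = 0 := by
    intro x hx y
    have h1 : L x = 0 := by
      have := hL.mul_left hΦ hx 1
      rwa [hL.map_one hΦ, mul_zero, mul_one] at this
    rw [gradientForm, h1, hL.mul_right hΦ hx, hL.map_star hΦ, mul_zero, zero_add, sub_self,
      smul_zero]
  have hΓ : {x : T.M | gradientForm L x x = 0} = T.NinM :=
    Set.Subset.antisymm hgrad fun x hx => hgrad' x hx x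
  refine ⟨?_, hΓ.trans hker.symm, hker.trans hmult.symm, hmult.trans hfix.symm, hfix⟩
  exact Set.Subset.antisymm (fun x hx => hgrad' x (hgrad x hx)) fun x hx => hx x
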